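/- **Setting.** All algebras are unital and over $\mathbb{C}$. Let $\mathfrak g$ be a finite-dimensional complex simple Lie algebra with a Cartan subalgebra and simple roots $\alpha_1,\dots,\alpha_r$, let $(\cdot,\cdot)$ be the invariant form normalised so that the shortest simple roots satisfy $(\alpha_i,\alpha_i)=2$, and put $d_i=(\alpha_i,\alpha_i)/2$, $a_{ij}=2(\alpha_i,\alpha_j)/(\alpha_i,\alpha_i)$. Let $q\in\mathbb R\setminus\{-1,0,1\}$ and $q_i=q^{d_i}$. $U_q(\mathfrak g)$ is the Drinfeld–Jimbo Hopf $*$-algebra with generators $E_i,F_i,K_i^{\pm1}$ and relations $K_iE_j=q_i^{a_{ij}}E_jK_i$, $K_iF_j=q_i^{-a_{ij}}F_jK_i$, $K_iK_j=K_jK_i$, $K_iK_i^{-1}=K_i^{-1}K_i=1$, $[E_i,F_j]=\delta_{ij}(K_i-K_i^{-1})/(q_i-q_i^{-1})$ and the quantum Serre relations, with $\Delta E_i=E_i\otimes K_i+1\otimes E_i$, $\Delta F_i=F_i\otimes1+K_i^{-1}\otimes F_i$, $\Delta K_i=K_i\otimes K_i$, and $*$-structure $K_i^*=K_i$, $E_i^*=K_iF_i$,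 $F_i^*=E_iK_i^{-1}$. Let $A=\mathcal O_q(G)$ be the Hopf $*$-algebra spanned by the matrix coefficients of the finite-dimensional type-1 representations of $U_q(\mathfrak g)$ (those with a basis of vectors on which every $K_i$ acts by an integral power of $q_i$), with the structure dual to that of $U_q(\mathfrak g)$ and $\langle X,f^*\rangle=\overline{\langle S(X)^*,f\rangle}$. A *CMQGA* is a finitely generated cosemisimple Hopf $*$-algebra whose Haar functional $\mathbf h$ satisfies $\mathbf h(a^*a)>0$ for all $a\neq0$. A *CQH-complex space over $A$* consists of the following. 1. A surjective Hopf $*$-algebra map $\pi:A\to H$, where $A$ and $H$ are CMQGAs and $A$ is a domain. Put $B=A^{\mathrm{co}(H)}=\{a\in A:(\mathrm{id}\otimes\pi)\Delta(a)=a\otimes1\}$, a $*$-subalgebra with left $A$-coaction $\Delta|_B:B\to A\otimes B$, and $B^+=B\cap\ker\varepsilon$. 2. A differential graded algebra $(\Omega^\bullet=\bigoplus_{k\ge0}\Omega^k,\mathrm d)$ with $\Omega^0=B$, generated as an algebra by the elements $b$, $\mathrm db$ ($b\in B$), of total degree $m\in\mathbb N_0$ (i.e. $\Omega^m\ne0$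 and $\Omega^k=0$ for $k>m$), such that: the $*$-map of $B$ extends to a conjugate-linear involution of $\Omega^\bullet$ with $\mathrm d(\omega^*)=(\mathrm d\omega)^*$ and $(\omega\wedge\nu)^*=(-1)^{kl}\nu^*\wedge\omega^*$ for $\omega\in\Omega^k$, $\nu\in\Omega^l$; the coaction of $B$ extends to a left $A$-comodule algebra structure on $\Omega^\bullet$ for which $\mathrm d$ is a comodule map; $\Omega^\bullet B^+\subseteq B^+\Omega^\bullet$; and $\dim_{\mathbb C}\Omega^\bullet/(B^+\Omega^\bullet)<\infty$. 3. An isomorphism $\mathrm{vol}:\Omega^m\to B$ of $B$-bimodules and of left $A$-comodules which commutes with $*$ and satisfies $\mathbf h(\mathrm{vol}(\mathrm d\omega))=0$ for all $\omega\in\Omega^{m-1}$. 4. A covariant complex structure: an $\mathbb N_0^2$-algebra grading $\Omega^\bullet=\bigoplus_{a,b\ge0}\Omega^{(a,b)}$ by left $A$-subcomodules with $\Omega^k=\bigoplus_{a+b=k}\Omega^{(a,b)}$, $(\Omega^{(a,b)})^*=\Omega^{(b,a)}$ and $\mathrm d\,\Omega^{(a,b)}\subseteq\Omega^{(a+1,b)}\oplus\Omega^{(a,b+1)}$.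 Write $H^0=\ker(\mathrm d:\Omega^0\to\Omega^1)$. The calculus is *connected* if $H^0=\mathbb C1$. A left $A$-comodule $M$ is *multiplicity-free* if $\dim_{\mathbb C}\mathrm{Hom}^A(V,M)\le1$ for every irreducible left $A$-comodule $V$. **Lemma.** For every CQH-complex space over $A=\mathcal O_q(G)$ for which $\Omega^0$ is multiplicity-free as a left $A$-comodule, the following are equivalent: 1. the calculus $\Omega^\bullet$ is connected; 2. $\dim_{\mathbb C}H^0<\infty$. -/

import Mathlib

open scoped TensorProduct

universe u v w

namespace QuantumHomogeneous

noncomputable section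

/-! ## Quantum integers and the quantum Serre polynomials -/

/-- The quantum integer `[n]_x = x ^ (1 - n) + x ^ (3 - n) + ⋯ + x ^ (n - 1)`. -/
def qInt (x : ℂ) (n : ℕ) : ℂ :=
  ∑ k ∈ Finset.range n, x ^ (2 * (k : ℤ) + 1 - (n : ℤ))

/-- The quantum factorial `[n]_x!`. -/
def qFactorial (x : ℂ) (n : ℕ) : ℂ :=
  ∏ k ∈ Finset.range n, qInt x (k + 1)

/-- The quantum binomial coefficient `[n]_x! / ([r]_x! [n - r]_x!)`, for `r ≤ n`. -/
def qBinom (x : ℂ) (n r : ℕ) : ℂ :=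
  qFactorial x n / (qFactorial x r * qFactorial x (n - r))

/-- The quantum Serre polynomial
`∑_{r = 0}^{N} (-1)^r [N choose r]_x X ^ (N - r) Y X ^ r`. -/
def serre {R : Type*} [Ring R] [Algebra ℂ R] (x : ℂ) (N : ℕ) (X Y : R) : R :=
  ∑ r ∈ Finset.range (N + 1), ((-1) ^ r * qBinom x N r) • (X ^ (N - r) * Y * X ^ r)

theorem qInt_mul {x : ℂ} (hx : x ≠ 0) (n : ℕ) :
    qInt x n * (x - x⁻¹) = x ^ (n : ℤ) - x ^ (-(n : ℤ)) := by
  have key : ∀ m : ℕ, (∑ k ∈ Finset.range m, x ^ (2 * (k : ℤ))) * (x - x⁻¹)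
      = x ^ (2 * (m : ℤ) - 1) - x⁻¹ := by
    intro m
    induction m with
    | zero => simp
    | succ m ih =>
      rw [Finset.sum_range_succ, add_mul, ih]
      push_cast
      rw [show (2 * ((m : ℤ) + 1) - 1) = 2 * m + 1 by ring, zpow_add_one₀ hx, zpow_sub_one₀ hx]
      ring
  have h : qInt x n = x ^ (1 - (n : ℤ)) * ∑ k ∈ Finset.range n, x ^ (2 * (k : ℤ)) := by
    rw [qInt, Finset.mul_sum]
    refine Finset.sum_congr rfl fun k _ => ?_
    rw [← zpow_add₀ hx]; congr 1; ring
  rw [h, mul_assoc, key, mul_sub, ← zpow_add₀ hx, ← zpow_sub_one₀ hx]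
  congr 2 <;> ring

/-- `x` is a non-zero number with `x ^ n ≠ 1` for all `n ≥ 1`. -/
def Generic (x : ℂ) : Prop := x ≠ 0 ∧ ∀ n : ℕ, 0 < n → x ^ n ≠ 1

theorem Generic.inv {x : ℂ} (hx : Generic x) : Generic x⁻¹ :=
  ⟨inv_ne_zero hx.1, fun n hn h => hx.2 n hn (by rwa [inv_pow, inv_eq_one] at h)⟩

theorem Generic.sub_inv_ne {x : ℂ} (hx : Generic x) : x - x⁻¹ ≠ 0 := by
  intro h
  have h1 : x = x⁻¹ := sub_eq_zero.mp h
  apply hx.2 2 two_pos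
  rw [pow_two]; nth_rewrite 2 [h1]; exact mul_inv_cancel₀ hx.1

theorem Generic.qInt_ne {x : ℂ} (hx : Generic x) {n : ℕ} (hn : 0 < n) : qInt x n ≠ 0 := by
  intro h
  have h1 := qInt_mul hx.1 n
  rw [h, zero_mul, eq_comm, sub_eq_zero] at h1
  apply hx.2 (n + n) (by omega)
  rw [zpow_neg, zpow_natCast] at h1
  rw [pow_add]; nth_rewrite 2 [h1]; exact mul_inv_cancel₀ (pow_ne_zero _ hx.1)

theorem Generic.qFactorial_ne {x : ℂ} (hx : Generic x) (n : ℕ) : qFactorial x n ≠ 0 :=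
  Finset.prod_ne_zero_iff.mpr fun _ _ => hx.qInt_ne (Nat.succ_pos _)

theorem qFactorial_succ (x : ℂ) (n : ℕ) :
    qFactorial x (n + 1) = qFactorial x n * qInt x (n + 1) := by
  simp [qFactorial, Finset.prod_range_succ]

theorem qInt_inv (x : ℂ) (n : ℕ) : qInt x⁻¹ n = qInt x n := by
  rw [qInt, qInt, ← Finset.sum_range_reflect]
  refine Finset.sum_congr rfl fun k hk => ?_
  have hk' : k < n := Finset.mem_range.mp hk
  rw [inv_zpow', show ((n - 1 - k : ℕ) : ℤ) = (n : ℤ) - 1 - k by omega]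
  congr 1; ring

theorem qBinom_inv (x : ℂ) (n r : ℕ) : qBinom x⁻¹ n r = qBinom x n r := by
  simp [qBinom, qFactorial, qInt_inv]

theorem Generic.qBinom_zero {x : ℂ} (hx : Generic x) (n : ℕ) : qBinom x n 0 = 1 := by
  simp only [qBinom, Nat.sub_zero]
  have := hx.qFactorial_ne n
  have h0 : qFactorial x 0 = 1 := by simp [qFactorial]
  rw [h0, one_mul, div_self this]

theorem Generic.qBinom_self {x : ℂ} (hx : Generic x) (n : ℕ) : qBinom x n n = 1 := by
  simp only [qBinom, Nat.sub_self]
  have := hx.qFactorial_ne n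
  have h0 : qFactorial x 0 = 1 := by simp [qFactorial]
  rw [h0, mul_one, div_self this]

theorem Generic.qBinom_pascal {x : ℂ} (hx : Generic x) {n r : ℕ} (h : r < n) :
    qBinom x (n + 1) (r + 1) =
      x ^ (-((r : ℤ) + 1)) * qBinom x n (r + 1) + x ^ ((n : ℤ) - r) * qBinom x n r := by
  obtain ⟨m, rfl⟩ : ∃ m, n = r + 1 + m := ⟨n - (r + 1), by omega⟩
  have e1 : r + 1 + m + 1 - (r + 1) = m + 1 := by omega
  have e2 : r + 1 + m - (r + 1) = m := by omega
  have e3 : r + 1 + m - r = m + 1 := by omega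
  simp only [qBinom, e1, e2, e3]
  rw [qFactorial_succ x (r + 1 + m), qFactorial_succ x m, qFactorial_succ x r]
  have a1 := hx.qFactorial_ne r
  have a2 := hx.qFactorial_ne m
  have a3 := hx.qInt_ne (Nat.succ_pos r)
  have a4 := hx.qInt_ne (Nat.succ_pos m)
  have key : qInt x (r + 1 + m + 1) =
      x ^ (-((r : ℤ) + 1)) * qInt x (m + 1) + x ^ (((r + 1 + m : ℕ) : ℤ) - r) * qInt x (r + 1) := by
    apply mul_right_cancel₀ hx.sub_inv_ne
    rw [add_mul, mul_assoc, mul_assoc, qInt_mul hx.1, qInt_mul hx.1, qInt_mul hx.1]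
    rw [mul_sub, mul_sub, ← zpow_add₀ hx.1, ← zpow_add₀ hx.1, ← zpow_add₀ hx.1, ← zpow_add₀ hx.1]
    push_cast
    ring_nf
  rw [key]
  field_simp

/-- Iterated `q`-commutators, used to handle the Serre polynomials. -/
def serreIter {R : Type*} [Ring R] [Algebra ℂ R] (c p : ℂ) (X Y : R) : ℕ → R
  | 0 => Y
  | n + 1 => X * serreIter c p X Y n - (c * p ^ n) • (serreIter c p X Y n * X)

section SerreLemmas

variable {R : Type*} [Ring R] [Algebra ℂ R]

theorem serreIter_eq {x : ℂ} (hx : Generic x) (c : ℂ) (X Y : R) (n : ℕ) :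
    serreIter c (x ^ 2) X Y n = ∑ r ∈ Finset.range (n + 1),
      ((-1) ^ r * c ^ r * x ^ ((r : ℤ) * (n - 1)) * qBinom x n r) • (X ^ (n - r) * Y * X ^ r) := by
  induction n with
  | zero => simp [serreIter, hx.qBinom_zero]
  | succ n ih =>
    rw [serreIter, ih]
    have L1 : X * ∑ r ∈ Finset.range (n + 1), ((-1) ^ r * c ^ r * x ^ ((r : ℤ) * (n - 1)) *
        qBinom x n r) • (X ^ (n - r) * Y * X ^ r) =
        (∑ r ∈ Finset.range n, ((-1) ^ (r + 1) * c ^ (r + 1) * x ^ (((r : ℤ) + 1) * (n - 1)) *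
        qBinom x n (r + 1)) • (X ^ (n - r) * Y * X ^ (r + 1))) + X ^ (n + 1) * Y := by
      rw [Finset.sum_range_succ', mul_add, Finset.mul_sum]
      congr 1
      · refine Finset.sum_congr rfl fun r hr => ?_
        have hr' := Finset.mem_range.mp hr
        rw [mul_smul_comm, show n - r = (n - (r + 1)) + 1 by omega, pow_succ' X (n - (r + 1))]
        push_cast
        simp only [mul_assoc]
      · simp [hx.qBinom_zero, pow_succ', mul_assoc]
    have L2 : (c * (x ^ 2) ^ n) • ((∑ r ∈ Finset.range (n + 1), ((-1) ^ r * c ^ r *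
        x ^ ((r : ℤ) * (n - 1)) * qBinom x n r) • (X ^ (n - r) * Y * X ^ r)) * X) =
        (∑ r ∈ Finset.range n, (c * (x ^ 2) ^ n * ((-1) ^ r * c ^ r * x ^ ((r : ℤ) * (n - 1)) *
        qBinom x n r)) • (X ^ (n - r) * Y * X ^ (r + 1))) +
        (c * (x ^ 2) ^ n * ((-1) ^ n * c ^ n * x ^ ((n : ℤ) * (n - 1)))) • (Y * X ^ (n + 1)) := by
      rw [Finset.sum_mul, Finset.smul_sum, Finset.sum_range_succ]
      congr 1
      · refine Finset.sum_congr rfl fun r hr => ?_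
        rw [smul_mul_assoc, smul_smul, pow_succ X r]
        simp only [mul_assoc]
      · rw [smul_mul_assoc, smul_smul, hx.qBinom_self, pow_succ X n]
        simp [mul_assoc]
    rw [L1, L2, Finset.sum_range_succ', Finset.sum_range_succ, add_sub_add_comm,
      ← Finset.sum_sub_distrib, add_assoc]
    congr 1
    · refine Finset.sum_congr rfl fun r hr => ?_
      have hr' := Finset.mem_range.mp hr
      rw [← sub_smul, hx.qBinom_pascal hr', show n + 1 - (r + 1) = n - r by omega]
      congr 1
      have e1 : x ^ (((r + 1 : ℕ) : ℤ) * (((n + 1 : ℕ) : ℤ) - 1)) * x ^ (-((r : ℤ) + 1)) =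
          x ^ (((r : ℤ) + 1) * (n - 1)) := by
        rw [← zpow_add₀ hx.1]; congr 1; push_cast; ring
      have e2 : x ^ (((r + 1 : ℕ) : ℤ) * (((n + 1 : ℕ) : ℤ) - 1)) * x ^ ((n : ℤ) - r) =
          (x ^ 2) ^ n * x ^ ((r : ℤ) * (n - 1)) := by
        rw [← zpow_add₀ hx.1, ← pow_mul, ← zpow_natCast x (2 * n), ← zpow_add₀ hx.1]
        congr 1; push_cast; ring
      rw [mul_add, mul_assoc _ (x ^ _) (x ^ _ * _), ← mul_assoc (x ^ _) (x ^ _) (qBinom _ _ _), e1,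
        mul_assoc _ (x ^ _) (x ^ _ * _), ← mul_assoc (x ^ _) (x ^ _) (qBinom _ _ _), e2]
      ring
    · rw [sub_eq_neg_add]
      congr 1
      · rw [hx.qBinom_self, ← neg_smul]
        have : x ^ (((n + 1 : ℕ) : ℤ) * (((n + 1 : ℕ) : ℤ) - 1)) =
            (x ^ 2) ^ n * x ^ ((n : ℤ) * (n - 1)) := by
          rw [← pow_mul, ← zpow_natCast x (2 * n), ← zpow_add₀ hx.1]
          congr 1; push_cast; ring
        rw [this]
        simp only [Nat.sub_self, pow_zero, one_mul]
        congr 1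
        ring
      · simp [hx.qBinom_zero]

theorem serre_eq_iter {x : ℂ} (hx : Generic x) (X Y : R) (N : ℕ) :
    serre x N X Y = serreIter (x ^ (1 - (N : ℤ))) (x ^ 2) X Y N := by
  rw [serreIter_eq hx, serre]
  refine Finset.sum_congr rfl fun r _ => ?_
  congr 1
  have : (x ^ (1 - (N : ℤ))) ^ r * x ^ ((r : ℤ) * (N - 1)) = 1 := by
    rw [← zpow_natCast, ← zpow_mul, ← zpow_add₀ hx.1]
    rw [show (1 - (N : ℤ)) * r + r * (N - 1) = 0 by ring, zpow_zero]
  rw [mul_assoc ((-1) ^ r), this, mul_one]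

theorem serre_eq_iter' {x : ℂ} (hx : Generic x) (X Y : R) (N : ℕ) :
    serre x N X Y = serreIter (x ^ ((N : ℤ) - 1)) (x⁻¹ ^ 2) X Y N := by
  have h : serre x N X Y = serre x⁻¹ N X Y := by simp [serre, qBinom_inv]
  rw [h, serre_eq_iter hx.inv, inv_zpow', neg_sub]

/-- If `A B = p B A` and `A D = c D A`, the iterated commutators of `A + B` and `D` do not see
`A`. -/
theorem serreIter_add_left {c p : ℂ} {A B D : R} (hAB : A * B = p • (B * A))
    (hAD : A * D = c • (D * A)) (n : ℕ) :
    serreIter c p (A + B) D n = serreIter c p B D n ∧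
      A * serreIter c p B D n = (c * p ^ n) • (serreIter c p B D n * A) := by
  induction n with
  | zero => simpa [serreIter] using hAD
  | succ n ih =>
    obtain ⟨h1, h2⟩ := ih
    constructor
    · rw [serreIter, h1, serreIter, add_mul, mul_add, h2, smul_add]
      abel
    · rw [serreIter, mul_sub, ← mul_assoc, hAB, smul_mul_assoc, mul_assoc B A, h2, mul_smul_comm,
        mul_smul_comm, ← mul_assoc A, h2, smul_mul_assoc, mul_assoc _ A B, hAB, sub_mul, smul_sub]
      simp only [mul_smul_comm, smul_mul_assoc, smul_smul, mul_assoc]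
      congr 2 <;> ring_nf

/-- If `B A = p A B` and `C B = c⁻¹ B C`, the iterated commutators of `A + B` and `C` do not see
`B`. -/
theorem serreIter_add_right {c p : ℂ} {A B C : R} (hBA : A * B = p • (B * A))
    (hCB : B * C = c • (C * B)) (hp : p ≠ 0) (n : ℕ) :
    serreIter c p⁻¹ (A + B) C n = serreIter c p⁻¹ A C n := by
  rw [add_comm]
  refine (serreIter_add_left (p := p⁻¹) ?_ hCB n).1
  rw [hBA, smul_smul, inv_mul_cancel₀ hp, one_smul]

/-- Additivity of the Serre polynomial for `q`-commuting summands. -/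
theorem serre_add {x : ℂ} (hx : Generic x) {N : ℕ} {A B C D : R} (hAB : A * B = x ^ 2 • (B * A))
    (hAD : A * D = x ^ (1 - (N : ℤ)) • (D * A)) (hBC : C * B = x ^ (1 - (N : ℤ)) • (B * C)) :
    serre x N (A + B) (C + D) = serre x N A C + serre x N B D := by
  have hadd : serre x N (A + B) (C + D) = serre x N (A + B) C + serre x N (A + B) D := by
    simp only [serre, ← Finset.sum_add_distrib, mul_add, add_mul, smul_add]
  rw [hadd, serre_eq_iter' hx _ C, serre_eq_iter hx _ D, serre_eq_iter' hx, serre_eq_iter hx,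
    (serreIter_add_left hAB hAD N).1, inv_pow]
  rw [serreIter_add_right hAB ?_ (pow_ne_zero _ hx.1)]
  rw [hBC, smul_smul, ← zpow_add₀ hx.1]
  simp

theorem map_serre {R' : Type*} [Ring R'] [Algebra ℂ R'] (f : R →ₐ[ℂ] R') (x : ℂ) (N : ℕ)
    (X Y : R) : f (serre x N X Y) = serre x N (f X) (f Y) := by
  simp [serre]

theorem serre_smul (x : ℂ) (N : ℕ) (s t : ℂ) (X Y : R) :
    serre x N (s • X) (t • Y) = (s ^ N * t) • serre x N X Y := by
  rw [serre, serre, Finset.smul_sum]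
  refine Finset.sum_congr rfl fun r hr => ?_
  have hr' : r ≤ N := Nat.lt_succ_iff.mp (Finset.mem_range.mp hr)
  rw [smul_pow, smul_pow]
  simp only [smul_mul_assoc, mul_smul_comm, smul_smul]
  congr 1
  obtain ⟨m, rfl⟩ : ∃ m, N = m + r := ⟨N - r, by omega⟩
  rw [Nat.add_sub_cancel]
  ring

/-- The Serre polynomial of elements `X = x k`, `Y = y l`, where `k`, `l` commute with each other
and `q`-commute with `x`, `y`. -/
theorem serre_mul {t p r : ℂ} {N : ℕ} {a k b l : R} (hka : k * a = p • (a * k))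
    (hkb : k * b = r • (b * k)) (hla : l * a = r • (a * l)) (hkl : k * l = l * k) :
    ∃ s : ℂ, ∃ w : R, serre t N (a * k) (b * l) = s • (serre t N a b * w) := by
  have kan : ∀ n : ℕ, k * a ^ n = p ^ n • (a ^ n * k) := by
    intro n
    induction n with
    | zero => simp
    | succ n ih =>
      rw [pow_succ, ← mul_assoc, ih, smul_mul_assoc, mul_assoc _ k a, hka, mul_smul_comm,
        smul_smul, pow_succ]
      simp only [mul_assoc]
  have knan : ∀ m n : ℕ, k ^ m * a ^ n = p ^ (m * n) • (a ^ n * k ^ m) := by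
    intro m n
    induction m with
    | zero => simp
    | succ m ih =>
      rw [pow_succ', mul_assoc, ih, mul_smul_comm, ← mul_assoc, kan, smul_mul_assoc, smul_smul]
      rw [mul_assoc, ← pow_succ', ← pow_add]
      congr 2
      ring
  have knb : ∀ m : ℕ, k ^ m * b = r ^ m • (b * k ^ m) := by
    intro m
    induction m with
    | zero => simp
    | succ m ih =>
      rw [pow_succ', mul_assoc, ih, mul_smul_comm, ← mul_assoc, hkb, smul_mul_assoc, smul_smul,
        mul_assoc, ← pow_succ]
  have lan : ∀ n : ℕ, l * a ^ n = r ^ n • (a ^ n * l) := by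
    intro n
    induction n with
    | zero => simp
    | succ n ih =>
      rw [pow_succ, ← mul_assoc, ih, smul_mul_assoc, mul_assoc _ l a, hla, mul_smul_comm,
        smul_smul, pow_succ]
      simp only [mul_assoc]
  have akn : ∀ n : ℕ, (a * k) ^ n = p ^ (n * (n - 1) / 2) • (a ^ n * k ^ n) := by
    intro n
    induction n with
    | zero => simp
    | succ n ih =>
      rw [pow_succ, ih, smul_mul_assoc, mul_assoc, ← mul_assoc (k ^ n)]
      have := knan n 1
      rw [pow_one, mul_one] at this
      rw [this, smul_mul_assoc, mul_smul_comm, smul_smul, pow_succ a, pow_succ k, ← pow_add]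
      congr 1
      · congr 1
        have h3 : (n + 1) * (n + 1 - 1) = n * (n - 1) + n * 2 := by
          cases n with
          | zero => rfl
          | succ n => simp only [Nat.add_sub_cancel]; ring
        rw [h3, Nat.add_mul_div_right _ _ two_pos]
      · simp only [mul_assoc]
  have hlk : ∀ n : ℕ, l * k ^ n = k ^ n * l := fun n =>
    ((Commute.pow_left (show Commute k l from hkl) n).eq).symm
  refine ⟨p ^ (N * (N - 1) / 2) * r ^ N, k ^ N * l, ?_⟩
  rw [serre, serre, Finset.sum_mul, Finset.smul_sum]
  refine Finset.sum_congr rfl fun j hj => ?_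
  have hj' : j ≤ N := Nat.lt_succ_iff.mp (Finset.mem_range.mp hj)
  obtain ⟨m, rfl⟩ : ∃ m, N = m + j := ⟨N - j, by omega⟩
  rw [Nat.add_sub_cancel, akn, akn, smul_mul_assoc, smul_mul_assoc, mul_smul_comm, smul_mul_assoc]
  have main : a ^ m * k ^ m * (b * l) * (a ^ j * k ^ j) =
      (r ^ (m + j) * p ^ (m * j)) • (a ^ m * b * a ^ j * (k ^ (m + j) * l)) := by
    calc a ^ m * k ^ m * (b * l) * (a ^ j * k ^ j)
        = a ^ m * (k ^ m * b) * (l * a ^ j) * k ^ j := by simp only [mul_assoc]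
      _ = (r ^ m * r ^ j) • (a ^ m * b * (k ^ m * a ^ j) * (l * k ^ j)) := by
          rw [knb, lan]
          simp only [mul_smul_comm, smul_mul_assoc, smul_smul, mul_assoc]
          rw [mul_comm]
      _ = (r ^ m * r ^ j * p ^ (m * j)) • (a ^ m * b * a ^ j * (k ^ m * (l * k ^ j))) := by
          rw [knan]
          simp only [mul_smul_comm, smul_mul_assoc, smul_smul, mul_assoc]
      _ = _ := by
          rw [hlk, ← mul_assoc (k ^ m), ← pow_add, ← pow_add]
  rw [main]
  simp only [smul_smul]
  congr 1
  have hT : (m + j) * (m + j - 1) / 2 = m * (m - 1) / 2 + j * (j - 1) / 2 + m * j := by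
    have e : (m + j) * (m + j - 1) = m * (m - 1) + j * (j - 1) + (m * j) * 2 := by
      rcases m with _ | m
      · simp
      rcases j with _ | j
      · simp
      simp only [show m + 1 + (j + 1) - 1 = m + j + 1 by omega, Nat.add_sub_cancel]
      ring
    rw [e, Nat.add_mul_div_right _ _ two_pos,
      Nat.add_div_of_dvd_right (Nat.even_mul_pred_self m).two_dvd]
  rw [hT, pow_add p (_ + _), pow_add p (_ / 2)]
  ring

/-- The Serre polynomial is symmetric under reversal of products, up to a sign. -/
theorem serre_op (x : ℂ) (N : ℕ) (X Y : R) :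
    serre x N (MulOpposite.op X) (MulOpposite.op Y) =
      MulOpposite.op ((-1 : ℂ) ^ N • serre x N X Y) := by
  rw [serre, serre, ← Finset.sum_range_reflect, Finset.smul_sum, Finset.op_sum]
  refine Finset.sum_congr rfl fun r hr => ?_
  have hr' : r ≤ N := Nat.lt_succ_iff.mp (Finset.mem_range.mp hr)
  have e1 : N + 1 - 1 - r = N - r := by omega
  have e2 : N - (N - r) = r := by omega
  rw [e1, e2, smul_smul, MulOpposite.op_smul]
  have e3 : (-1 : ℂ) ^ (N - r) = (-1) ^ N * (-1) ^ r := by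
    obtain ⟨m, rfl⟩ : ∃ m, N = m + r := ⟨N - r, by omega⟩
    rw [Nat.add_sub_cancel, pow_add, mul_assoc, ← pow_add, ← two_mul, pow_mul]
    simp
  have e4 : qBinom x N (N - r) = qBinom x N r := by
    rw [qBinom, qBinom, e2, mul_comm (qFactorial x (N - r))]
  rw [e3, e4]
  congr 1
  · ring
  · simp [mul_assoc]

end SerreLemmas

/-! ## Quantised enveloping algebras -/

/-- A symmetrised generalised Cartan matrix `a`, with symmetriser `d`, together with a real
deformation parameter `q ∉ {-1, 0, 1}`. -/
structure CartanDatum (ι : Type u) where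
  a : ι → ι → ℤ
  d : ι → ℕ
  q : ℝ
  a_self : ∀ i, a i i = 2
  a_nonpos : ∀ i j, i ≠ j → a i j ≤ 0
  symm : ∀ i j, (d i : ℤ) * a i j = d j * a j i
  d_pos : ∀ i, 0 < d i
  q_ne_zero : q ≠ 0
  q_ne_one : q ≠ 1
  q_ne_neg_one : q ≠ -1

/-- Names for the generators of a quantised enveloping algebra. -/
inductive Gen (ι : Type u) : Type u
  | E (i : ι)
  | F (i : ι)
  | K (i : ι)
  | Kinv (i : ι)

variable {ι : Type u} (D : CartanDatum ι)

/-- `q_i = q ^ (d_i)`. -/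
def CartanDatum.qi (i : ι) : ℂ := (D.q : ℂ) ^ D.d i

/-- The defining relations of the quantised enveloping algebra, for families of elements
`e, f, k, k'` of an algebra. -/
structure QRelations {R : Type*} [Ring R] [Algebra ℂ R] (e f k k' : ι → R) : Prop where
  k_e : ∀ i j, k i * e j = (D.qi i ^ D.a i j) • (e j * k i)
  k_f : ∀ i j, k i * f j = (D.qi i ^ (-D.a i j)) • (f j * k i)
  k_k : ∀ i j, k i * k j = k j * k i
  k_k' : ∀ i, k i * k' i = 1
  k'_k : ∀ i, k' i * k i = 1
  e_f_self : ∀ i, e i * f i - f i * e i = (D.qi i - (D.qi i)⁻¹)⁻¹ • (k i - k' i)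
  e_f_ne : ∀ i j, i ≠ j → e i * f j - f j * e i = 0
  serre_e : ∀ i j, i ≠ j → serre (D.qi i) (1 - D.a i j).toNat (e i) (e j) = 0
  serre_f : ∀ i j, i ≠ j → serre (D.qi i) (1 - D.a i j).toNat (f i) (f j) = 0

/-- The defining relations of the quantised enveloping algebra, as relations in the free algebra
on the generators. -/
inductive Rel : FreeAlgebra ℂ (Gen ι) → FreeAlgebra ℂ (Gen ι) → Prop
  | k_e (i j) : Rel (.ι ℂ (.K i) * .ι ℂ (.E j))
      ((D.qi i ^ D.a i j) • (.ι ℂ (.E j) * .ι ℂ (.K i)))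
  | k_f (i j) : Rel (.ι ℂ (.K i) * .ι ℂ (.F j))
      ((D.qi i ^ (-D.a i j)) • (.ι ℂ (.F j) * .ι ℂ (.K i)))
  | k_k (i j) : Rel (.ι ℂ (.K i) * .ι ℂ (.K j)) (.ι ℂ (.K j) * .ι ℂ (.K i))
  | k_k' (i) : Rel (.ι ℂ (.K i) * .ι ℂ (.Kinv i)) 1
  | k'_k (i) : Rel (.ι ℂ (.Kinv i) * .ι ℂ (.K i)) 1
  | e_f_self (i) : Rel (.ι ℂ (.E i) * .ι ℂ (.F i) - .ι ℂ (.F i) * .ι ℂ (.E i))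
      ((D.qi i - (D.qi i)⁻¹)⁻¹ • (.ι ℂ (.K i) - .ι ℂ (.Kinv i)))
  | e_f_ne (i j) : i ≠ j → Rel (.ι ℂ (.E i) * .ι ℂ (.F j) - .ι ℂ (.F j) * .ι ℂ (.E i)) 0
  | serre_e (i j) : i ≠ j →
      Rel (serre (D.qi i) (1 - D.a i j).toNat (.ι ℂ (.E i)) (.ι ℂ (.E j))) 0
  | serre_f (i j) : i ≠ j →
      Rel (serre (D.qi i) (1 - D.a i j).toNat (.ι ℂ (.F i)) (.ι ℂ (.F j))) 0

/-- The quantised enveloping algebra `U_q`. -/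
def Uq : Type u := RingQuot (Rel D)

namespace Uq

instance : Ring (Uq D) := inferInstanceAs (Ring (RingQuot (Rel D)))
instance : Algebra ℂ (Uq D) := inferInstanceAs (Algebra ℂ (RingQuot (Rel D)))

/-- The quotient map from the free algebra. -/
def mk : FreeAlgebra ℂ (Gen ι) →ₐ[ℂ] Uq D := RingQuot.mkAlgHom ℂ (Rel D)

/-- The generators. -/
def gen (g : Gen ι) : Uq D := mk D (.ι ℂ g)
/-- The generator `E_i`. -/
abbrev E (i : ι) : Uq D := gen D (.E i)
/-- The generator `F_i`. -/
abbrev F (i : ι) : Uq D := gen D (.F i)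
/-- The generator `K_i`. -/
abbrev K (i : ι) : Uq D := gen D (.K i)
/-- The generator `K_i⁻¹`. -/
abbrev Kinv (i : ι) : Uq D := gen D (.Kinv i)

theorem mk_rel {x y : FreeAlgebra ℂ (Gen ι)} (h : Rel D x y) : mk D x = mk D y :=
  RingQuot.mkAlgHom_rel ℂ h

theorem relations : QRelations D (E D) (F D) (K D) (Kinv D) where
  k_e i j := by simpa [gen] using mk_rel D (.k_e i j)
  k_f i j := by simpa [gen] using mk_rel D (.k_f i j)
  k_k i j := by simpa [gen] using mk_rel D (.k_k i j)
  k_k' i := by simpa [gen] using mk_rel D (.k_k' i)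
  k'_k i := by simpa [gen] using mk_rel D (.k'_k i)
  e_f_self i := by simpa [gen] using mk_rel D (.e_f_self i)
  e_f_ne i j h := by simpa [gen] using mk_rel D (.e_f_ne i j h)
  serre_e i j h := by simpa [gen, map_serre] using mk_rel D (.serre_e i j h)
  serre_f i j h := by simpa [gen, map_serre] using mk_rel D (.serre_f i j h)

variable {D}

/-- The images of the generators under an assignment. -/
def genMap {R : Type*} (e f k k' : ι → R) : Gen ι → R
  | .E i => e i
  | .F i => f i
  | .K i => k i
  | .Kinv i => k' i

theorem lift_aux {R : Type*} [Ring R] [Algebra ℂ R] {e f k k' : ι → R}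
    (h : QRelations D e f k k') ⦃x y : FreeAlgebra ℂ (Gen ι)⦄ (hxy : Rel D x y) :
    FreeAlgebra.lift ℂ (genMap e f k k') x = FreeAlgebra.lift ℂ (genMap e f k k') y := by
  cases hxy with
  | k_e i j => simpa [genMap] using h.k_e i j
  | k_f i j => simpa [genMap] using h.k_f i j
  | k_k i j => simpa [genMap] using h.k_k i j
  | k_k' i => simpa [genMap] using h.k_k' i
  | k'_k i => simpa [genMap] using h.k'_k i
  | e_f_self i => simpa [genMap] using h.e_f_self i
  | e_f_ne i j hij => simpa [genMap] using h.e_f_ne i j hij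
  | serre_e i j hij => simpa [genMap, map_serre] using h.serre_e i j hij
  | serre_f i j hij => simpa [genMap, map_serre] using h.serre_f i j hij

/-- The universal property of `U_q`. -/
def lift {R : Type*} [Ring R] [Algebra ℂ R] {e f k k' : ι → R} (h : QRelations D e f k k') :
    Uq D →ₐ[ℂ] R :=
  RingQuot.liftAlgHom ℂ ⟨FreeAlgebra.lift ℂ (genMap e f k k'), lift_aux h⟩

@[simp] theorem lift_gen {R : Type*} [Ring R] [Algebra ℂ R] {e f k k' : ι → R}
    (h : QRelations D e f k k') (g : Gen ι) : lift h (gen D g) = genMap e f k k' g := by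
  have := RingQuot.liftAlgHom_mkAlgHom_apply ℂ (FreeAlgebra.lift ℂ (genMap e f k k'))
    (lift_aux h) (FreeAlgebra.ι ℂ g)
  rw [FreeAlgebra.lift_ι_apply] at this
  exact this

theorem induction {p : Uq D → Prop} (hgen : ∀ g, p (gen D g)) (halg : ∀ c : ℂ, p (algebraMap _ _ c))
    (hadd : ∀ x y, p x → p y → p (x + y)) (hmul : ∀ x y, p x → p y → p (x * y)) (x : Uq D) :
    p x := by
  obtain ⟨y, rfl⟩ := RingQuot.mkAlgHom_surjective ℂ (Rel D) x
  change p (mk D y)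
  induction y using FreeAlgebra.induction with
  | grade0 r => simpa using halg r
  | grade1 g => exact hgen g
  | mul a b ha hb => rw [map_mul]; exact hmul _ _ ha hb
  | add a b ha hb => rw [map_add]; exact hadd _ _ ha hb

theorem algHom_ext {R : Type*} [Ring R] [Algebra ℂ R] {f g : Uq D →ₐ[ℂ] R}
    (h : ∀ x, f (gen D x) = g (gen D x)) : f = g := by
  ext x
  induction x using Uq.induction with
  | hgen x => exact h x
  | halg c => simp
  | hadd x y hx hy => simp [hx, hy]
  | hmul x y hx hy => simp [hx, hy]

end Uq

section QRelationsLemmas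

variable {D}

theorem CartanDatum.qi_ne_zero (i : ι) : D.qi i ≠ 0 :=
  pow_ne_zero _ (by exact_mod_cast D.q_ne_zero)

theorem CartanDatum.qi_generic (i : ι) : Generic (D.qi i) := by
  refine ⟨D.qi_ne_zero i, fun n hn h => ?_⟩
  rw [CartanDatum.qi, ← pow_mul] at h
  have h2 : D.q ^ (D.d i * n) = 1 := by exact_mod_cast h
  have h3 : |D.q| = 1 := (pow_eq_one_iff_of_nonneg (abs_nonneg _)
    (Nat.mul_pos (D.d_pos i) hn).ne').mp (by rw [← abs_pow, h2, abs_one])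
  rcases (abs_eq zero_le_one).mp h3 with h4 | h4
  · exact D.q_ne_one h4
  · exact D.q_ne_neg_one h4

theorem CartanDatum.qi_symm (i j : ι) : D.qi j ^ D.a j i = D.qi i ^ D.a i j := by
  rw [CartanDatum.qi, CartanDatum.qi, ← zpow_natCast, ← zpow_natCast, ← zpow_mul, ← zpow_mul,
    D.symm]

theorem CartanDatum.one_sub_toNat {i j : ι} (h : i ≠ j) :
    1 - (((1 - D.a i j).toNat : ℕ) : ℤ) = D.a i j := by
  have := D.a_nonpos i j h
  omega

variable {R : Type*} [Ring R] [Algebra ℂ R] {e f k k' : ι → R}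

theorem QRelations.k'_q (h : QRelations D e f k k')
    {i : ι} {x : R} {c : ℂ} (hc : c ≠ 0) (hx : k i * x = c • (x * k i)) :
    k' i * x = c⁻¹ • (x * k' i) := by
  have h1 : k' i * (k i * x) * k' i = k' i * (c • (x * k i)) * k' i := by rw [hx]
  rw [← mul_assoc, h.k'_k, one_mul, mul_smul_comm, smul_mul_assoc, mul_assoc, mul_assoc, h.k_k',
    mul_one] at h1
  rw [h1, smul_smul, inv_mul_cancel₀ hc, one_smul]

theorem QRelations.k'_e (h : QRelations D e f k k')
    (i j : ι) : k' i * e j = (D.qi i ^ (-D.a i j)) • (e j * k' i) := by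
  rw [zpow_neg]
  exact h.k'_q (zpow_ne_zero _ (D.qi_ne_zero i)) (h.k_e i j)

theorem QRelations.k'_f (h : QRelations D e f k k')
    (i j : ι) : k' i * f j = (D.qi i ^ (D.a i j)) • (f j * k' i) := by
  have := h.k'_q (zpow_ne_zero _ (D.qi_ne_zero i)) (h.k_f i j)
  rwa [zpow_neg, inv_inv] at this

theorem QRelations.k'_comm_k (h : QRelations D e f k k')
    (i j : ι) : k' i * k j = k j * k' i := by
  have := h.k'_q (i := i) (c := 1) (x := k j) one_ne_zero (by simpa using h.k_k i j)
  simpa using this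

theorem QRelations.k'_comm_k' (h : QRelations D e f k k')
    (i j : ι) : k' i * k' j = k' j * k' i := by
  have := h.k'_q (i := i) (c := 1) (x := k' j) one_ne_zero
    (by simpa using (h.k'_comm_k j i).symm)
  simpa using this

end QRelationsLemmas

/-! ### The Hopf algebra structure of `U_q` -/

namespace Uq

variable {D}

theorem comul_relations : QRelations D (R := Uq D ⊗[ℂ] Uq D)
    (fun i => E D i ⊗ₜ K D i + 1 ⊗ₜ E D i) (fun i => F D i ⊗ₜ 1 + Kinv D i ⊗ₜ F D i)
    (fun i => K D i ⊗ₜ K D i) (fun i => Kinv D i ⊗ₜ Kinv D i) := by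
  have h := relations D
  refine ⟨?_, ?_, ?_, ?_, ?_, ?_, ?_, ?_, ?_⟩
  · intro i j
    simp only [mul_add, add_mul, Algebra.TensorProduct.tmul_mul_tmul, h.k_e, h.k_k i j, one_mul,
      mul_one, smul_add, TensorProduct.smul_tmul', TensorProduct.tmul_smul]
  · intro i j
    simp only [mul_add, add_mul, Algebra.TensorProduct.tmul_mul_tmul, h.k_f, one_mul,
      mul_one, smul_add, TensorProduct.smul_tmul', TensorProduct.tmul_smul, h.k'_comm_k j i]
  · intro i j
    simp only [Algebra.TensorProduct.tmul_mul_tmul, h.k_k i j]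
  · intro i
    simp only [Algebra.TensorProduct.tmul_mul_tmul, h.k_k', Algebra.TensorProduct.one_def]
  · intro i
    simp only [Algebra.TensorProduct.tmul_mul_tmul, h.k'_k, Algebra.TensorProduct.one_def]
  · intro i
    have e := h.e_f_self i
    have e1 : E D i * F D i = F D i * E D i + (D.qi i - (D.qi i)⁻¹)⁻¹ • (K D i - Kinv D i) := by
      rw [← e]; abel
    simp only [mul_add, add_mul, Algebra.TensorProduct.tmul_mul_tmul, one_mul, mul_one, e1,
      h.k_f, h.k'_e, TensorProduct.add_tmul, TensorProduct.tmul_add, TensorProduct.smul_tmul',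
      TensorProduct.tmul_smul, smul_sub, TensorProduct.sub_tmul, TensorProduct.tmul_sub]
    abel
  · intro i j hij
    have e1 : E D i * F D j = F D j * E D i := sub_eq_zero.mp (h.e_f_ne i j hij)
    have e2 : D.qi j ^ (-D.a j i) = D.qi i ^ (-D.a i j) := by
      rw [zpow_neg, zpow_neg, D.qi_symm]
    simp only [mul_add, add_mul, Algebra.TensorProduct.tmul_mul_tmul, one_mul, mul_one, e1,
      h.k_f, h.k'_e, TensorProduct.smul_tmul', TensorProduct.tmul_smul, e2]
    abel
  · intro i j hij
    have hx := D.qi_generic i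
    rw [serre_add hx]
    · have e1 : serre (D.qi i) (1 - D.a i j).toNat (E D i ⊗ₜ[ℂ] K D i) (E D j ⊗ₜ[ℂ] K D j) = 0 := by
        obtain ⟨s, w, hs⟩ := serre_mul (t := D.qi i) (N := (1 - D.a i j).toNat) (p := 1) (r := 1)
          (a := E D i ⊗ₜ[ℂ] (1 : Uq D)) (b := E D j ⊗ₜ[ℂ] (1 : Uq D))
          (k := (1 : Uq D) ⊗ₜ[ℂ] K D i) (l := (1 : Uq D) ⊗ₜ[ℂ] K D j)
          (by simp) (by simp) (by simp) (by simp [h.k_k i j])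
        have e0 := map_serre (Algebra.TensorProduct.includeLeft (R := ℂ) (S := ℂ) (A := Uq D)
          (B := Uq D)) (D.qi i) (1 - D.a i j).toNat (E D i) (E D j)
        rw [h.serre_e i j hij, map_zero] at e0
        simp only [Algebra.TensorProduct.includeLeft_apply] at e0
        rw [← e0] at hs
        simpa using hs
      have e2 := map_serre (Algebra.TensorProduct.includeRight (R := ℂ) (A := Uq D)
          (B := Uq D)) (D.qi i) (1 - D.a i j).toNat (E D i) (E D j)
      rw [h.serre_e i j hij, map_zero] at e2
      simp only [Algebra.TensorProduct.includeRight_apply] at e2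
      rw [e1, ← e2, add_zero]
    · have := h.k_e i i
      rw [D.a_self] at this
      simp only [Algebra.TensorProduct.tmul_mul_tmul, one_mul, mul_one, this,
        TensorProduct.tmul_smul]
      norm_cast
    · rw [CartanDatum.one_sub_toNat hij]
      simp only [Algebra.TensorProduct.tmul_mul_tmul, one_mul, mul_one, h.k_e,
        TensorProduct.tmul_smul]
    · rw [CartanDatum.one_sub_toNat hij, ← D.qi_symm]
      simp only [Algebra.TensorProduct.tmul_mul_tmul, one_mul, mul_one, h.k_e,
        TensorProduct.tmul_smul]
  · intro i j hij
    have hx := D.qi_generic i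
    rw [add_comm, add_comm (F D j ⊗ₜ[ℂ] (1 : Uq D)), serre_add hx]
    · have e1 : serre (D.qi i) (1 - D.a i j).toNat (Kinv D i ⊗ₜ[ℂ] F D i)
          (Kinv D j ⊗ₜ[ℂ] F D j) = 0 := by
        obtain ⟨s, w, hs⟩ := serre_mul (t := D.qi i) (N := (1 - D.a i j).toNat) (p := 1) (r := 1)
          (a := (1 : Uq D) ⊗ₜ[ℂ] F D i) (b := (1 : Uq D) ⊗ₜ[ℂ] F D j)
          (k := Kinv D i ⊗ₜ[ℂ] (1 : Uq D)) (l := Kinv D j ⊗ₜ[ℂ] (1 : Uq D))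
          (by simp) (by simp) (by simp) (by simp [h.k'_comm_k' i j])
        have e0 := map_serre (Algebra.TensorProduct.includeRight (R := ℂ) (A := Uq D)
          (B := Uq D)) (D.qi i) (1 - D.a i j).toNat (F D i) (F D j)
        rw [h.serre_f i j hij, map_zero] at e0
        simp only [Algebra.TensorProduct.includeRight_apply] at e0
        rw [← e0] at hs
        simpa using hs
      have e2 := map_serre (Algebra.TensorProduct.includeLeft (R := ℂ) (S := ℂ) (A := Uq D)
          (B := Uq D)) (D.qi i) (1 - D.a i j).toNat (F D i) (F D j)
      rw [h.serre_f i j hij, map_zero] at e2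
      simp only [Algebra.TensorProduct.includeLeft_apply] at e2
      rw [e1, ← e2, add_zero]
    · have := h.k'_f i i
      rw [D.a_self] at this
      simp only [Algebra.TensorProduct.tmul_mul_tmul, one_mul, mul_one, this,
        TensorProduct.smul_tmul']
      norm_cast
    · rw [CartanDatum.one_sub_toNat hij]
      simp only [Algebra.TensorProduct.tmul_mul_tmul, one_mul, mul_one, h.k'_f,
        TensorProduct.smul_tmul']
    · rw [CartanDatum.one_sub_toNat hij, ← D.qi_symm]
      simp only [Algebra.TensorProduct.tmul_mul_tmul, one_mul, mul_one, h.k'_f,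
        TensorProduct.smul_tmul']

theorem counit_relations : QRelations D (R := ℂ) (fun _ => 0) (fun _ => 0) (fun _ => 1)
    (fun _ => 1) := by
  have hs : ∀ (x : ℂ) (N : ℕ), serre x N (0 : ℂ) 0 = 0 := by
    intro x N
    simp [serre]
  constructor <;> simp [hs]

/-- The comultiplication of `U_q`: `Δ E_i = E_i ⊗ K_i + 1 ⊗ E_i`,
`Δ F_i = F_i ⊗ 1 + K_i⁻¹ ⊗ F_i`, `Δ K_i = K_i ⊗ K_i`. -/
def comulHom : Uq D →ₐ[ℂ] Uq D ⊗[ℂ] Uq D := lift comul_relations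

/-- The counit of `U_q`: `ε E_i = ε F_i = 0`, `ε K_i = 1`. -/
def counitHom : Uq D →ₐ[ℂ] ℂ := lift counit_relations

instance : Bialgebra ℂ (Uq D) := by
  refine Bialgebra.ofAlgHom comulHom counitHom ?_ ?_ ?_
  · apply algHom_ext
    rintro (i | i | i | i) <;>
    simp [comulHom, genMap, TensorProduct.add_tmul, TensorProduct.tmul_add, add_assoc,
      Algebra.TensorProduct.one_def]
  · apply algHom_ext
    rintro (i | i | i | i) <;>
    simp [comulHom, counitHom, genMap]
  · apply algHom_ext
    rintro (i | i | i | i) <;>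
    simp [comulHom, counitHom, genMap]

theorem comul_eq (x : Uq D) : Coalgebra.comul (R := ℂ) x = comulHom x := rfl
theorem counit_eq (x : Uq D) : Coalgebra.counit (R := ℂ) x = counitHom x := rfl

theorem antipode_relations : QRelations D (R := (Uq D)ᵐᵒᵖ)
    (fun i => .op (-(E D i * Kinv D i))) (fun i => .op (-(K D i * F D i)))
    (fun i => .op (Kinv D i)) (fun i => .op (K D i)) := by
  have h := relations D
  have hq : ∀ i j, D.qi i ^ D.a i j ≠ 0 := fun i j => zpow_ne_zero _ (D.qi_ne_zero i)
  refine ⟨?_, ?_, ?_, ?_, ?_, ?_, ?_, ?_, ?_⟩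
  · intro i j
    rw [← MulOpposite.op_mul, ← MulOpposite.op_mul, ← MulOpposite.op_smul, mul_neg, ← mul_assoc,
      h.k'_e, neg_mul, mul_assoc, h.k'_comm_k' j i, smul_mul_assoc, smul_neg, smul_smul, zpow_neg,
      mul_inv_cancel₀ (hq i j), one_smul, mul_assoc]
  · intro i j
    rw [← MulOpposite.op_mul, ← MulOpposite.op_mul, ← MulOpposite.op_smul, mul_neg, ← mul_assoc,
      h.k'_comm_k i j, neg_mul, mul_assoc (K D j), mul_assoc (K D j), h.k'_f, smul_neg,
      mul_smul_comm, smul_smul, zpow_neg, inv_mul_cancel₀ (hq i j), one_smul]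
  · intro i j
    rw [← MulOpposite.op_mul, ← MulOpposite.op_mul, h.k'_comm_k']
  · intro i
    rw [← MulOpposite.op_mul, h.k_k', MulOpposite.op_one]
  · intro i
    rw [← MulOpposite.op_mul, h.k'_k, MulOpposite.op_one]
  · intro i
    rw [← MulOpposite.op_mul, ← MulOpposite.op_mul, ← MulOpposite.op_sub, ← MulOpposite.op_sub,
      ← MulOpposite.op_smul]
    congr 1
    have e1 : -(K D i * F D i) * -(E D i * Kinv D i) = K D i * (F D i * E D i) * Kinv D i := by
      simp only [neg_mul_neg, mul_assoc]
    have e2 : -(E D i * Kinv D i) * -(K D i * F D i) = E D i * F D i := by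
      rw [neg_mul_neg, mul_assoc, ← mul_assoc (Kinv D i), h.k'_k, one_mul]
    have e3 : K D i * (F D i * E D i) = F D i * E D i * K D i := by
      rw [← mul_assoc, h.k_f, smul_mul_assoc, mul_assoc, h.k_e, mul_smul_comm, smul_smul,
        zpow_neg, inv_mul_cancel₀ (hq i i), one_smul, mul_assoc]
    rw [e1, e2, e3, mul_assoc, h.k_k', mul_one, ← neg_sub, h.e_f_self, ← smul_neg, neg_sub]
  · intro i j hij
    rw [← MulOpposite.op_mul, ← MulOpposite.op_mul, ← MulOpposite.op_sub]
    rw [MulOpposite.op_eq_zero_iff]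
    have e0 : E D i * F D j = F D j * E D i := sub_eq_zero.mp (h.e_f_ne i j hij)
    have e1 : -(K D j * F D j) * -(E D i * Kinv D i) = K D j * (F D j * E D i) * Kinv D i := by
      simp only [neg_mul_neg, mul_assoc]
    have e2 : -(E D i * Kinv D i) * -(K D j * F D j) = K D j * (F D j * E D i) * Kinv D i := by
      have hh : D.qi j ^ D.a j i = D.qi i ^ D.a i j := D.qi_symm i j
      rw [neg_mul_neg, mul_assoc, ← mul_assoc (Kinv D i), h.k'_comm_k i j, mul_assoc (K D j),
        h.k'_f, mul_smul_comm, mul_smul_comm, ← mul_assoc, ← e0, ← mul_assoc (K D j) (E D i), h.k_e, hh,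
        smul_mul_assoc, smul_mul_assoc]
      simp only [mul_assoc]
    rw [e1, e2, sub_self]
  · intro i j hij
    obtain ⟨s, w, hs⟩ := serre_mul (t := D.qi i) (N := (1 - D.a i j).toNat)
      (h.k'_e i i) (h.k'_e i j) (l := Kinv D j) (by rw [h.k'_e, zpow_neg, D.qi_symm, ← zpow_neg])
      (h.k'_comm_k' i j)
    have := serre_smul (D.qi i) (1 - D.a i j).toNat (-1) (-1) (E D i * Kinv D i) (E D j * Kinv D j)
    rw [neg_one_smul, neg_one_smul] at this
    rw [serre_op, this, hs, h.serre_e i j hij]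
    simp
  · intro i j hij
    obtain ⟨s, w, hs⟩ := serre_mul (t := D.qi i) (N := (1 - D.a i j).toNat)
      (h.k_f i i) (h.k_f i j) (l := K D j) (by rw [h.k_f, zpow_neg, D.qi_symm, ← zpow_neg])
      (h.k_k i j)
    have := serre_smul (D.qi i) (1 - D.a i j).toNat (-D.qi i ^ (-D.a i i)) (-D.qi j ^ (-D.a j j))
      (F D i * K D i) (F D j * K D j)
    rw [serre_op, h.k_f, h.k_f, ← neg_smul, ← neg_smul, this, hs, h.serre_f i j hij]
    simp

/-- The antipode of `U_q`, as a homomorphism to the opposite algebra: `S E_i = -E_i K_i⁻¹`,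
`S F_i = -K_i F_i`, `S K_i = K_i⁻¹`. -/
def antipodeHom : Uq D →ₐ[ℂ] (Uq D)ᵐᵒᵖ := lift antipode_relations

/-- The antipode of `U_q`, as a linear map. -/
def S : Uq D →ₗ[ℂ] Uq D := (MulOpposite.opLinearEquiv ℂ).symm.toLinearMap ∘ₗ antipodeHom.toLinearMap

theorem S_apply (x : Uq D) : S x = (antipodeHom x).unop := rfl

theorem S_mul (x y : Uq D) : S (x * y) = S y * S x := by simp [S_apply]

theorem S_one : S (1 : Uq D) = 1 := by simp [S_apply]

open Coalgebra in
theorem S_left (x : Uq D) : LinearMap.mul' ℂ (Uq D) (S.rTensor (Uq D) (comul (R := ℂ) x)) =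
    algebraMap ℂ (Uq D) (counit (R := ℂ) x) := by
  have h := relations D
  induction x using Uq.induction with
  | hgen g =>
    rcases g with i | i | i | i <;>
    simp [comul_eq, counit_eq, comulHom, counitHom, genMap, S_apply, antipodeHom, h.k_k', h.k'_k,
      mul_assoc]
  | halg c => simp [S_apply, Algebra.TensorProduct.algebraMap_apply]
  | hadd x y hx hy => simp [hx, hy]
  | hmul x y hx hy =>
    have k1 : ∀ (s : Uq D ⊗[ℂ] Uq D) (c d : Uq D),
        LinearMap.mul' ℂ (Uq D) (S.rTensor (Uq D) (s * (c ⊗ₜ d))) =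
          S c * LinearMap.mul' ℂ (Uq D) (S.rTensor (Uq D) s) * d := by
      intro s c d
      induction s using TensorProduct.induction_on with
      | zero => simp
      | add a b ha hb => simp only [add_mul, map_add, ha, hb, mul_add]
      | tmul a b => simp [S_mul, mul_assoc]
    have k2 : ∀ t : Uq D ⊗[ℂ] Uq D,
        LinearMap.mul' ℂ (Uq D) (S.rTensor (Uq D) (comul (R := ℂ) x * t)) =
          algebraMap ℂ (Uq D) (counit (R := ℂ) x) *
            LinearMap.mul' ℂ (Uq D) (S.rTensor (Uq D) t) := by
      intro t
      induction t using TensorProduct.induction_on with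
      | zero => simp
      | add a b ha hb => simp only [mul_add, map_add, ha, hb]
      | tmul c d =>
        rw [k1, hx, ← Algebra.commutes]
        simp [mul_assoc]
    rw [Bialgebra.comul_mul, k2, hy, Bialgebra.counit_mul, map_mul]

open Coalgebra in
theorem S_right (x : Uq D) : LinearMap.mul' ℂ (Uq D) (S.lTensor (Uq D) (comul (R := ℂ) x)) =
    algebraMap ℂ (Uq D) (counit (R := ℂ) x) := by
  have h := relations D
  induction x using Uq.induction with
  | hgen g =>
    rcases g with i | i | i | i <;>
    simp [comul_eq, counit_eq, comulHom, counitHom, genMap, S_apply, antipodeHom, h.k_k', h.k'_k,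
      ← mul_assoc]
  | halg c => simp [S_apply, Algebra.TensorProduct.algebraMap_apply]
  | hadd x y hx hy => simp [hx, hy]
  | hmul x y hx hy =>
    have k1 : ∀ (t : Uq D ⊗[ℂ] Uq D) (a b : Uq D),
        LinearMap.mul' ℂ (Uq D) (S.lTensor (Uq D) ((a ⊗ₜ b) * t)) =
          a * LinearMap.mul' ℂ (Uq D) (S.lTensor (Uq D) t) * S b := by
      intro t a b
      induction t using TensorProduct.induction_on with
      | zero => simp
      | add c d hc hd => simp only [add_mul, map_add, hc, hd, mul_add]
      | tmul c d => simp [S_mul, mul_assoc]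
    have k2 : ∀ s : Uq D ⊗[ℂ] Uq D,
        LinearMap.mul' ℂ (Uq D) (S.lTensor (Uq D) (s * comul (R := ℂ) y)) =
          LinearMap.mul' ℂ (Uq D) (S.lTensor (Uq D) s) *
            algebraMap ℂ (Uq D) (counit (R := ℂ) y) := by
      intro s
      induction s using TensorProduct.induction_on with
      | zero => simp
      | add a b ha hb => simp only [add_mul, map_add, ha, hb]
      | tmul c d =>
        rw [k1, hy, mul_assoc, Algebra.commutes]
        simp [mul_assoc]
    rw [Bialgebra.comul_mul, k2, hx, Bialgebra.counit_mul, map_mul]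

instance : HopfAlgebra ℂ (Uq D) where
  antipode := S
  mul_antipode_rTensor_comul := LinearMap.ext S_left
  mul_antipode_lTensor_comul := LinearMap.ext S_right

end Uq

/-! ### The compact real form -/

/-- The complex conjugate of a complex algebra: the same ring, where a scalar acts as its
conjugate did. -/
def Cj (R : Type*) : Type _ := R

instance {R : Type*} [Ring R] : Ring (Cj R) := inferInstanceAs (Ring R)
instance {R : Type*} [Ring R] [Algebra ℂ R] : Algebra ℂ (Cj R) :=
  Algebra.compHom (A := R) (starRingEnd ℂ)

theorem Cj.smul_def {R : Type*} [Ring R] [Algebra ℂ R] (c : ℂ) (x : R) :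
    (c • (show Cj R from x) : Cj R) = (show Cj R from (starRingEnd ℂ c • x : R)) :=
  (Algebra.smul_def (R := ℂ) (A := Cj R) c x).trans (Algebra.smul_def (R := ℂ) (A := R) _ x).symm

theorem conj_qBinom {x : ℂ} (hx : starRingEnd ℂ x = x) (n r : ℕ) :
    starRingEnd ℂ (qBinom x n r) = qBinom x n r := by
  simp [qBinom, qFactorial, qInt, hx]

theorem serre_cj {R : Type*} [Ring R] [Algebra ℂ R] {x : ℂ} (hx : starRingEnd ℂ x = x) (N : ℕ)
    (X Y : R) : serre (R := Cj R) x N X Y = serre (R := R) x N X Y := by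
  refine Finset.sum_congr rfl fun r _ => ?_
  refine (Cj.smul_def (R := R) _ _).trans ?_
  rw [map_mul, conj_qBinom hx, map_pow, map_neg, map_one]
  rfl

namespace Uq

variable {D}

theorem conj_qi (i : ι) : starRingEnd ℂ (D.qi i) = D.qi i := by simp [CartanDatum.qi]

theorem star_relations : QRelations D (R := Cj (Uq D)ᵐᵒᵖ)
    (fun i => MulOpposite.op (K D i * F D i)) (fun i => MulOpposite.op (E D i * Kinv D i))
    (fun i => MulOpposite.op (K D i)) (fun i => MulOpposite.op (Kinv D i)) := by
  have h := relations D
  have hq : ∀ i j, D.qi i ^ D.a i j ≠ 0 := fun i j => zpow_ne_zero _ (D.qi_ne_zero i)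
  have hc : ∀ i (n : ℤ), starRingEnd ℂ (D.qi i ^ n) = D.qi i ^ n := by
    intro i n
    rw [map_zpow₀, conj_qi]
  refine ⟨?_, ?_, ?_, ?_, ?_, ?_, ?_, ?_, ?_⟩
  · intro i j
    refine Eq.trans ?_ (Cj.smul_def _ _).symm
    rw [hc]
    change MulOpposite.op (K D j * F D j * K D i) =
      (D.qi i ^ D.a i j) • MulOpposite.op (K D i * (K D j * F D j))
    rw [← MulOpposite.op_smul, ← mul_assoc (K D i), h.k_k i j, mul_assoc (K D j), mul_assoc (K D j),
      h.k_f, mul_smul_comm, smul_smul, zpow_neg, mul_inv_cancel₀ (hq i j), one_smul]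
  · intro i j
    refine Eq.trans ?_ (Cj.smul_def _ _).symm
    rw [hc]
    change MulOpposite.op (E D j * Kinv D j * K D i) =
      (D.qi i ^ (-D.a i j)) • MulOpposite.op (K D i * (E D j * Kinv D j))
    rw [← MulOpposite.op_smul, ← mul_assoc (K D i), h.k_e, smul_mul_assoc, smul_smul, zpow_neg,
      inv_mul_cancel₀ (hq i j), one_smul, mul_assoc, mul_assoc, h.k'_comm_k]
  · intro i j
    exact congrArg MulOpposite.op (h.k_k j i)
  · intro i
    exact congrArg MulOpposite.op (h.k'_k i)
  · intro i
    exact congrArg MulOpposite.op (h.k_k' i)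
  · intro i
    refine Eq.trans ?_ (Cj.smul_def _ _).symm
    rw [map_inv₀, map_sub, map_inv₀, conj_qi]
    change MulOpposite.op (E D i * Kinv D i * (K D i * F D i) - K D i * F D i * (E D i * Kinv D i)) =
      (D.qi i - (D.qi i)⁻¹)⁻¹ • MulOpposite.op (K D i - Kinv D i)
    rw [← MulOpposite.op_smul, ← h.e_f_self]
    congr 1
    have e3 : K D i * (F D i * E D i) = F D i * E D i * K D i := by
      rw [← mul_assoc, h.k_f, smul_mul_assoc, mul_assoc, h.k_e, mul_smul_comm, smul_smul,
        zpow_neg, inv_mul_cancel₀ (hq i i), one_smul, mul_assoc]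
    congr 1
    · rw [mul_assoc, ← mul_assoc (Kinv D i), h.k'_k, one_mul]
    · rw [mul_assoc, ← mul_assoc (F D i), ← mul_assoc, e3, mul_assoc, h.k_k', mul_one]
  · intro i j hij
    change MulOpposite.op (E D j * Kinv D j * (K D i * F D i) - K D i * F D i * (E D j * Kinv D j)) = 0
    have e0 : E D j * F D i = F D i * E D j := sub_eq_zero.mp (h.e_f_ne j i hij.symm)
    rw [MulOpposite.op_eq_zero_iff, sub_eq_zero]
    have e1 : K D i * F D i * (E D j * Kinv D j) = K D i * E D j * F D i * Kinv D j := by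
      rw [mul_assoc, ← mul_assoc (F D i), ← e0]; simp only [mul_assoc]
    have e2 : E D j * Kinv D j * (K D i * F D i) = E D j * K D i * (Kinv D j * F D i) := by
      rw [mul_assoc, ← mul_assoc (Kinv D j), h.k'_comm_k]; simp only [mul_assoc]
    rw [e1, e2, h.k'_f, h.k_e, D.qi_symm, mul_smul_comm, smul_mul_assoc, smul_mul_assoc]
    simp only [mul_assoc]
  · intro i j hij
    refine (serre_cj (conj_qi i) _ _ _).trans ?_
    obtain ⟨s, w, hs⟩ := serre_mul (t := D.qi i) (N := (1 - D.a i j).toNat)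
      (h.k_f i i) (h.k_f i j) (l := K D j) (by rw [h.k_f, zpow_neg, D.qi_symm, ← zpow_neg])
      (h.k_k i j)
    have := serre_smul (D.qi i) (1 - D.a i j).toNat (D.qi i ^ (-D.a i i)) (D.qi j ^ (-D.a j j))
      (F D i * K D i) (F D j * K D j)
    rw [serre_op, h.k_f, h.k_f, this, hs, h.serre_f i j hij]
    simp
    rfl
  · intro i j hij
    refine (serre_cj (conj_qi i) _ _ _).trans ?_
    obtain ⟨s, w, hs⟩ := serre_mul (t := D.qi i) (N := (1 - D.a i j).toNat)
      (h.k'_e i i) (h.k'_e i j) (l := Kinv D j) (by rw [h.k'_e, zpow_neg, D.qi_symm, ← zpow_neg])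
      (h.k'_comm_k' i j)
    rw [serre_op, hs, h.serre_e i j hij]
    simp
    rfl

/-- The compact real form `E_i* = K_i F_i`, `F_i* = E_i K_i⁻¹`, `K_i* = K_i`, as a homomorphism to
the complex conjugate of the opposite algebra. -/
def starHom : Uq D →ₐ[ℂ] Cj (Uq D)ᵐᵒᵖ := lift star_relations

instance : Star (Uq D) := ⟨fun x => MulOpposite.unop (show (Uq D)ᵐᵒᵖ from starHom x)⟩

theorem star_mul' (x y : Uq D) : star (x * y) = star y * star x :=
  congrArg MulOpposite.unop (map_mul starHom x y)

theorem star_add' (x y : Uq D) : star (x + y) = star x + star y :=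
  congrArg MulOpposite.unop (map_add starHom x y)

theorem star_smul' (c : ℂ) (x : Uq D) : star (c • x) = starRingEnd ℂ c • star x :=
  congrArg MulOpposite.unop ((map_smul starHom c x).trans (Cj.smul_def c (R := (Uq D)ᵐᵒᵖ) _))

theorem star_one' : star (1 : Uq D) = 1 := congrArg MulOpposite.unop (map_one starHom)

theorem star_E (i : ι) : star (E D i) = K D i * F D i :=
  congrArg MulOpposite.unop (lift_gen star_relations (.E i))
theorem star_F (i : ι) : star (F D i) = E D i * Kinv D i :=
  congrArg MulOpposite.unop (lift_gen star_relations (.F i))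
theorem star_K (i : ι) : star (K D i) = K D i :=
  congrArg MulOpposite.unop (lift_gen star_relations (.K i))
theorem star_Kinv (i : ι) : star (Kinv D i) = Kinv D i :=
  congrArg MulOpposite.unop (lift_gen star_relations (.Kinv i))

/-- The conjugate linear map `X ↦ S(X)*`. -/
def theta : Uq D →ₛₗ[starRingEnd ℂ] Uq D where
  toFun x := star (S x)
  map_add' x y := by rw [map_add, star_add']
  map_smul' c x := by rw [map_smul, star_smul']

theorem theta_apply (x : Uq D) : theta x = star (S x) := rfl

theorem theta_mul (x y : Uq D) : theta (x * y) = theta x * theta y := by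
  rw [theta_apply, S_mul, star_mul']; rfl

theorem theta_one : theta (1 : Uq D) = 1 := by
  rw [theta_apply, S_one, star_one']

theorem star_neg' (x : Uq D) : star (-x) = -star x := by
  rw [← neg_one_smul ℂ, star_smul']; simp

theorem theta_E (i : ι) : theta (E D i) = -F D i := by
  rw [theta_apply, S_apply, antipodeHom, lift_gen]
  simp only [genMap, MulOpposite.unop_op]
  rw [star_neg', star_mul', star_Kinv, star_E, ← mul_assoc, (relations D).k'_k, one_mul]

theorem theta_F (i : ι) : theta (F D i) = -E D i := by
  rw [theta_apply, S_apply, antipodeHom, lift_gen]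
  simp only [genMap, MulOpposite.unop_op]
  rw [star_neg', star_mul', star_K, star_F, mul_assoc, (relations D).k'_k, mul_one]

theorem theta_K (i : ι) : theta (K D i) = Kinv D i := by
  rw [theta_apply, S_apply, antipodeHom, lift_gen]
  simp only [genMap, MulOpposite.unop_op]
  rw [star_Kinv]

theorem theta_Kinv (i : ι) : theta (Kinv D i) = K D i := by
  rw [theta_apply, S_apply, antipodeHom, lift_gen]
  simp only [genMap, MulOpposite.unop_op]
  rw [star_K]

theorem theta_algebraMap (c : ℂ) :
    theta (algebraMap ℂ (Uq D) c) = algebraMap ℂ (Uq D) (starRingEnd ℂ c) := by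
  rw [Algebra.algebraMap_eq_smul_one, Algebra.algebraMap_eq_smul_one, LinearMap.map_smulₛₗ,
    theta_one]

theorem theta_theta (x : Uq D) : theta (theta x) = x := by
  induction x using Uq.induction with
  | hgen g => rcases g with i | i | i | i <;> simp [theta_E, theta_F, theta_K, theta_Kinv]
  | halg c => simp [theta_algebraMap]
  | hadd x y hx hy => simp [hx, hy]
  | hmul x y hx hy => simp [theta_mul, hx, hy]

theorem counit_theta (x : Uq D) :
    Coalgebra.counit (R := ℂ) (theta x) = starRingEnd ℂ (Coalgebra.counit (R := ℂ) x) := by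
  induction x using Uq.induction with
  | hgen g =>
    rcases g with i | i | i | i <;>
      simp [theta_E, theta_F, theta_K, theta_Kinv, counit_eq, counitHom, genMap]
  | halg c => simp [theta_algebraMap]
  | hadd x y hx hy => simp [hx, hy]
  | hmul x y hx hy => simp [theta_mul, hx, hy]

theorem comul_theta (x : Uq D) : Coalgebra.comul (R := ℂ) (theta x) =
    TensorProduct.comm ℂ _ _ (TensorProduct.map theta theta (Coalgebra.comul (R := ℂ) x)) := by
  have hmul : ∀ s t : Uq D ⊗[ℂ] Uq D,
      TensorProduct.comm ℂ _ _ (TensorProduct.map theta theta (s * t)) =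
      TensorProduct.comm ℂ _ _ (TensorProduct.map theta theta s) *
      TensorProduct.comm ℂ _ _ (TensorProduct.map theta theta t) := by
    intro s t
    induction s using TensorProduct.induction_on with
    | zero => simp
    | add a b ha hb => simp only [add_mul, map_add, ha, hb]
    | tmul a b =>
      induction t using TensorProduct.induction_on with
      | zero => simp
      | add a b ha hb => simp only [mul_add, map_add, ha, hb]
      | tmul c d => simp [theta_mul]
  induction x using Uq.induction with
  | hgen g =>
    rcases g with i | i | i | i <;>
      simp [theta_E, theta_F, theta_K, theta_Kinv, comul_eq, comulHom, genMap, theta_one,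
        TensorProduct.neg_tmul, TensorProduct.tmul_neg, add_comm]
  | halg c =>
    simp [theta_algebraMap, Algebra.TensorProduct.algebraMap_apply, theta_one,
      ← Algebra.TensorProduct.algebraMap_apply']
  | hadd x y hx hy => simp [hx, hy]
  | hmul x y hx hy => rw [theta_mul, Bialgebra.comul_mul, Bialgebra.comul_mul, hmul, hx, hy]

end Uq

/-! ## The quantised coordinate algebra -/

/-- A finite-dimensional type-one representation of `U_q`, written as a matrix representation with
respect to a basis of weight vectors: `K_i` acts on the `j`-th basis vector as
`q_i ^ (wt j i)`, with integers `wt j i`. -/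
structure TypeOneRep (J : Type) [Fintype J] [DecidableEq J] where
  ρ : Uq D →ₐ[ℂ] Matrix J J ℂ
  wt : J → ι → ℤ
  ρ_K : ∀ i, ρ (Uq.K D i) = Matrix.diagonal fun j => D.qi i ^ wt j i

namespace TypeOneRep

variable {D}
variable {J : Type} [Fintype J] [DecidableEq J] {J' : Type} [Fintype J'] [DecidableEq J']

/-- The matrix entries of a representation, as functionals on `U_q`. -/
def entry (T : TypeOneRep D J) (j k : J) : WithConv (Uq D →ₗ[ℂ] ℂ) :=
  .toConv (LinearMap.proj k ∘ₗ LinearMap.proj j ∘ₗ T.ρ.toLinearMap)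

@[simp] theorem entry_apply (T : TypeOneRep D J) (j k : J) (X : Uq D) :
    T.entry j k X = T.ρ X j k := rfl

theorem ρ_Kinv (T : TypeOneRep D J) (i : ι) :
    T.ρ (Uq.Kinv D i) = Matrix.diagonal fun j => D.qi i ^ (-T.wt j i) := by
  have h1 : T.ρ (Uq.Kinv D i) * T.ρ (Uq.K D i) = 1 := by
    rw [← map_mul, (Uq.relations D).k'_k, map_one]
  have h2 : T.ρ (Uq.K D i) * Matrix.diagonal (fun j => D.qi i ^ (-T.wt j i)) = 1 := by
    rw [T.ρ_K, Matrix.diagonal_mul_diagonal, ← Matrix.diagonal_one]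
    congr 1
    ext j
    rw [← zpow_add₀ (D.qi_ne_zero i), add_neg_cancel, zpow_zero]
  exact left_inv_eq_right_inv h1 h2

variable (D) in
/-- The trivial representation. -/
def triv : TypeOneRep D Unit where
  ρ := (Algebra.ofId ℂ (Matrix Unit Unit ℂ)).comp (Bialgebra.counitAlgHom ℂ (Uq D))
  wt _ _ := 0
  ρ_K i := by
    have : Coalgebra.counit (R := ℂ) (Uq.K D i) = 1 := by
      simp [Uq.counit_eq, Uq.counitHom, Uq.genMap]
    simp [this]

/-- The tensor product of matrices, as a homomorphism. -/
def kron (J : Type) [Fintype J] [DecidableEq J] (J' : Type) [Fintype J'] [DecidableEq J'] :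
    Matrix J J ℂ ⊗[ℂ] Matrix J' J' ℂ →ₐ[ℂ] Matrix (J × J') (J × J') ℂ :=
  (Algebra.TensorProduct.lmul' ℂ (S := ℂ)).mapMatrix.comp
    (Matrix.kroneckerTMulAlgEquiv J J' ℂ ℂ ℂ ℂ).toAlgHom

theorem kron_tmul (M : Matrix J J ℂ) (N : Matrix J' J' ℂ) (j k : J × J') :
    kron J J' (M ⊗ₜ N) j k = M j.1 k.1 * N j.2 k.2 := by
  simp [kron, Matrix.kroneckerMap]

/-- The tensor product of two representations. -/
def tmul (T : TypeOneRep D J) (T' : TypeOneRep D J') : TypeOneRep D (J × J') where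
  ρ := ((kron J J').comp (Algebra.TensorProduct.map T.ρ T'.ρ)).comp
    (Bialgebra.comulAlgHom ℂ (Uq D))
  wt j i := T.wt j.1 i + T'.wt j.2 i
  ρ_K i := by
    have h : Coalgebra.comul (R := ℂ) (Uq.K D i) = Uq.K D i ⊗ₜ Uq.K D i := by
      simp [Uq.comul_eq, Uq.comulHom, Uq.genMap]
    ext j k
    simp only [AlgHom.comp_apply, Bialgebra.comulAlgHom_apply, h, Algebra.TensorProduct.map_tmul,
      kron_tmul, T.ρ_K, T'.ρ_K]
    by_cases hjk : j = k
    · subst hjk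
      simp [zpow_add₀ (D.qi_ne_zero i)]
    · rw [Matrix.diagonal_apply_ne _ hjk]
      by_cases h1 : j.1 = k.1
      · have h2 : j.2 ≠ k.2 := fun h2 => hjk (Prod.ext h1 h2)
        rw [Matrix.diagonal_apply_ne _ h2, mul_zero]
      · rw [Matrix.diagonal_apply_ne _ h1, zero_mul]

theorem tmul_entry (T : TypeOneRep D J) (T' : TypeOneRep D J') (j k : J × J') :
    (T.tmul T').entry j k = T.entry j.1 k.1 * T'.entry j.2 k.2 := by
  refine WithConv.ext (LinearMap.ext fun X => ?_)
  change (kron J J') (Algebra.TensorProduct.map T.ρ T'.ρ (Coalgebra.comul (R := ℂ) X)) j k =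
    LinearMap.mul' ℂ ℂ (TensorProduct.map (T.entry j.1 k.1).ofConv (T'.entry j.2 k.2).ofConv
      (Coalgebra.comul (R := ℂ) X))
  induction Coalgebra.comul (R := ℂ) X using TensorProduct.induction_on with
  | zero => simp
  | add a b ha hb => rw [map_add, map_add, Matrix.add_apply, ha, hb, map_add, map_add]
  | tmul a b => rw [Algebra.TensorProduct.map_tmul, kron_tmul]; rfl

theorem triv_entry (j k : Unit) : (triv D).entry j k = 1 := by
  refine WithConv.ext (LinearMap.ext fun X => ?_)
  change (algebraMap ℂ (Matrix Unit Unit ℂ)) (Coalgebra.counit (R := ℂ) X) j k = _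
  simp [Matrix.algebraMap_matrix_apply]

/-- The contragredient representation. -/
def dual (T : TypeOneRep D J) : TypeOneRep D J where
  ρ := (Matrix.transposeAlgEquiv J ℂ ℂ).symm.toAlgHom.comp
    ((AlgHom.op T.ρ).comp Uq.antipodeHom)
  wt j i := -T.wt j i
  ρ_K i := by
    have h : (Uq.antipodeHom (Uq.K D i)) = .op (Uq.Kinv D i) := by
      simp [Uq.antipodeHom, Uq.genMap]
    simp [h, ρ_Kinv]

theorem dual_entry (T : TypeOneRep D J) (j k : J) (X : Uq D) :
    T.dual.entry j k X = T.entry k j (Uq.S X) := rfl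

/-- The conjugate of a representation. -/
def conj (T : TypeOneRep D J) : TypeOneRep D J where
  ρ :=
    { toFun X := (T.ρ (Uq.theta X)).map (starRingEnd ℂ)
      map_one' := by simp [Uq.theta_one]
      map_mul' X Y := by simp [Uq.theta_mul, Matrix.map_mul]
      map_zero' := by simp
      map_add' X Y := by simp [Matrix.map_add]
      commutes' c := by
        rw [Uq.theta_algebraMap]
        ext i j
        simp [Matrix.algebraMap_matrix_apply, apply_ite (starRingEnd ℂ)] }
  wt j i := -T.wt j i
  ρ_K i := by
    change (T.ρ (Uq.theta (Uq.K D i))).map (starRingEnd ℂ) = _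
    rw [Uq.theta_K, ρ_Kinv, Matrix.diagonal_map (map_zero _)]
    congr 1
    ext j
    simp [Uq.conj_qi]

theorem conj_entry (T : TypeOneRep D J) (j k : J) (X : Uq D) :
    T.conj.entry j k X = starRingEnd ℂ (T.entry j k (Uq.theta X)) := rfl

end TypeOneRep

/-- The matrix entries of type-one representations. -/
def coeffSet : Set (WithConv (Uq D →ₗ[ℂ] ℂ)) :=
  {f | ∃ (J : Type) (_ : Fintype J) (_ : DecidableEq J) (T : TypeOneRep D J) (j k : J),
    f = T.entry j k}

/-- The quantised coordinate algebra: the span of all matrix entries of finite-dimensional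
type-one representations of `U_q`, inside the convolution algebra of functionals on `U_q`. -/
def coordAlg : Subalgebra ℂ (WithConv (Uq D →ₗ[ℂ] ℂ)) :=
  (Submodule.span ℂ (coeffSet D)).toSubalgebra
    (Submodule.subset_span ⟨Unit, inferInstance, inferInstance, TypeOneRep.triv D, (), (),
      (TypeOneRep.triv_entry _ _).symm⟩)
    (by
      intro f g hf hg
      induction hf using Submodule.span_induction with
      | zero => simp
      | add a b _ _ ha hb => rw [add_mul]; exact add_mem ha hb
      | smul c a _ ha => rw [smul_mul_assoc]; exact Submodule.smul_mem _ _ ha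
      | mem a ha =>
        obtain ⟨J, _, _, T, j, k, rfl⟩ := ha
        induction hg using Submodule.span_induction with
        | zero => simp
        | add a b _ _ ha hb => rw [mul_add]; exact add_mem ha hb
        | smul c a _ ha => rw [mul_smul_comm]; exact Submodule.smul_mem _ _ ha
        | mem b hb =>
          obtain ⟨J', _, _, T', j', k', rfl⟩ := hb
          exact Submodule.subset_span ⟨J × J', inferInstance, inferInstance, T.tmul T', (j, j'),
            (k, k'), (T.tmul_entry T' (j, j') (k, k')).symm⟩)

/-- The quantised coordinate algebra, as a type. -/
def Oq : Type u := coordAlg D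

instance : Ring (Oq D) := inferInstanceAs (Ring (coordAlg D))
instance : Algebra ℂ (Oq D) := inferInstanceAs (Algebra ℂ (coordAlg D))

namespace Oq

variable {D}

theorem entry_mem {J : Type} [Fintype J] [DecidableEq J] (T : TypeOneRep D J) (j k : J) :
    T.entry j k ∈ coordAlg D :=
  Submodule.subset_span ⟨J, inferInstance, inferInstance, T, j, k, rfl⟩

/-- A matrix entry as an element of the quantised coordinate algebra. -/
def coeff {J : Type} [Fintype J] [DecidableEq J] (T : TypeOneRep D J) (j k : J) : Oq D :=
  ⟨T.entry j k, entry_mem T j k⟩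

theorem span_induction {p : Oq D → Prop}
    (hcoeff : ∀ (J : Type) [Fintype J] [DecidableEq J] (T : TypeOneRep D J) (j k : J),
      p (coeff T j k))
    (hzero : p 0) (hadd : ∀ f g, p f → p g → p (f + g)) (hsmul : ∀ (c : ℂ) f, p f → p (c • f))
    (f : Oq D) : p f := by
  obtain ⟨f, hf⟩ := f
  have hf' : f ∈ Submodule.span ℂ (coeffSet D) := hf
  induction hf' using Submodule.span_induction with
  | zero => exact hzero
  | mem x hx =>
    obtain ⟨J, _, _, T, j, k, rfl⟩ := hx
    exact hcoeff J T j k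
  | add a b ha hb iha ihb => exact hadd _ _ (iha ha) (ihb hb)
  | smul c a ha iha => exact hsmul c _ (iha ha)

/-- The evaluation pairing with `U_q`. -/
def ev : Oq D →ₗ[ℂ] Module.Dual ℂ (Uq D) where
  toFun f := f.1.ofConv
  map_add' _ _ := rfl
  map_smul' _ _ := rfl

theorem ev_injective : Function.Injective (ev (D := D)) :=
  fun _ _ h => Subtype.ext (WithConv.ext h)

theorem ext_ev {f g : Oq D} (h : ∀ X, ev f X = ev g X) : f = g :=
  ev_injective (LinearMap.ext h)

@[simp] theorem ev_coeff {J : Type} [Fintype J] [DecidableEq J] (T : TypeOneRep D J) (j k : J)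
    (X : Uq D) : ev (coeff T j k) X = T.ρ X j k := rfl

theorem ev_one (X : Uq D) : ev (1 : Oq D) X = Coalgebra.counit (R := ℂ) X := rfl

theorem ev_mul (f g : Oq D) (X : Uq D) : ev (f * g) X =
    LinearMap.mul' ℂ ℂ (TensorProduct.map (ev f) (ev g) (Coalgebra.comul (R := ℂ) X)) := rfl

/-- Functionals on a tensor product given by tensors of functionals. -/
def pairing {M N X Y : Type*} [AddCommGroup M] [Module ℂ M] [AddCommGroup N] [Module ℂ N]
    [AddCommGroup X] [Module ℂ X] [AddCommGroup Y] [Module ℂ Y]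
    (i : M →ₗ[ℂ] Module.Dual ℂ X) (j : N →ₗ[ℂ] Module.Dual ℂ Y) :
    M ⊗[ℂ] N →ₗ[ℂ] Module.Dual ℂ (X ⊗[ℂ] Y) :=
  TensorProduct.dualDistrib ℂ X Y ∘ₗ TensorProduct.map i j

theorem pairing_injective {M N X Y : Type*} [AddCommGroup M] [Module ℂ M] [AddCommGroup N]
    [Module ℂ N] [AddCommGroup X] [Module ℂ X] [AddCommGroup Y] [Module ℂ Y]
    {i : M →ₗ[ℂ] Module.Dual ℂ X} {j : N →ₗ[ℂ] Module.Dual ℂ Y} (hi : Function.Injective i)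
    (hj : Function.Injective j) : Function.Injective (pairing i j) := by
  rw [← LinearMap.ker_eq_bot, LinearMap.ker_eq_bot']
  intro t ht
  classical
  let b := Module.Basis.ofVectorSpace ℂ N
  obtain ⟨s, rfl⟩ := (TensorProduct.equivFinsuppOfBasisRight (M := M) b).symm.surjective t
  rw [TensorProduct.equivFinsuppOfBasisRight_symm_apply] at ht
  have h1 : ∀ x, (s.sum fun k m => i m x • b k) = 0 := by
    intro x
    apply hj
    ext y
    have := LinearMap.congr_fun ht (x ⊗ₜ y)
    rw [map_zero]
    simpa [pairing, Finsupp.sum] using this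
  have h2 : ∀ k, s k = 0 := by
    intro k
    apply hi
    ext x
    have h3 := congrArg (fun n => b.repr n k) (h1 x)
    simp only [Finsupp.sum, map_sum, map_smul, Module.Basis.repr_self, Finsupp.smul_single,
      Finsupp.coe_finsetSum, Finset.sum_apply, Finsupp.single_apply] at h3
    by_cases hk : k ∈ s.support
    · simpa [hk] using h3
    · simp [Finsupp.notMem_support_iff.mp hk]
  have : s = 0 := Finsupp.ext h2
  simp [this]

/-- The pairing of `O_q ⊗ O_q` with `U_q ⊗ U_q`. -/
def ev2 : Oq D ⊗[ℂ] Oq D →ₗ[ℂ] Module.Dual ℂ (Uq D ⊗[ℂ] Uq D) := pairing ev ev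

/-- The pairing of threefold tensor powers. -/
def ev3 : Oq D ⊗[ℂ] (Oq D ⊗[ℂ] Oq D) →ₗ[ℂ] Module.Dual ℂ (Uq D ⊗[ℂ] (Uq D ⊗[ℂ] Uq D)) :=
  pairing ev ev2

theorem ev2_injective : Function.Injective (ev2 (D := D)) :=
  pairing_injective ev_injective ev_injective

theorem ev3_injective : Function.Injective (ev3 (D := D)) :=
  pairing_injective ev_injective ev2_injective

@[simp] theorem ev2_tmul (f g : Oq D) (X Y : Uq D) : ev2 (f ⊗ₜ g) (X ⊗ₜ Y) = ev f X * ev g Y :=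
  rfl

@[simp] theorem ev3_tmul (f : Oq D) (t : Oq D ⊗[ℂ] Oq D) (X : Uq D) (Z : Uq D ⊗[ℂ] Uq D) :
    ev3 (f ⊗ₜ t) (X ⊗ₜ Z) = ev f X * ev2 t Z := rfl

theorem ext_ev2 {s t : Oq D ⊗[ℂ] Oq D} (h : ∀ X Y, ev2 s (X ⊗ₜ Y) = ev2 t (X ⊗ₜ Y)) : s = t :=
  ev2_injective (TensorProduct.ext' h)

theorem exists_comul (f : Oq D) : ∃ t, ev2 t = ev f ∘ₗ LinearMap.mul' ℂ (Uq D) := by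
  induction f using span_induction with
  | hcoeff J T j k =>
    refine ⟨∑ l, coeff T j l ⊗ₜ coeff T l k, TensorProduct.ext' fun X Y => ?_⟩
    simp [LinearMap.sum_apply, Matrix.mul_apply]
  | hzero => exact ⟨0, by ext; simp⟩
  | hadd f g hf hg =>
    obtain ⟨s, hs⟩ := hf
    obtain ⟨t, ht⟩ := hg
    exact ⟨s + t, by rw [map_add, hs, ht, map_add, LinearMap.add_comp]⟩
  | hsmul c f hf =>
    obtain ⟨s, hs⟩ := hf
    exact ⟨c • s, by rw [map_smul, hs, map_smul, LinearMap.smul_comp]⟩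

/-- The comultiplication of the quantised coordinate algebra, dual to the multiplication of
`U_q`. -/
def comulFun (f : Oq D) : Oq D ⊗[ℂ] Oq D := (exists_comul f).choose

theorem ev2_comulFun (f : Oq D) (X Y : Uq D) : ev2 (comulFun f) (X ⊗ₜ Y) = ev f (X * Y) :=
  LinearMap.congr_fun (exists_comul f).choose_spec (X ⊗ₜ Y)

/-- The comultiplication as a linear map. -/
def comulLin : Oq D →ₗ[ℂ] Oq D ⊗[ℂ] Oq D where
  toFun := comulFun
  map_add' f g := ext_ev2 fun X Y => by simp [ev2_comulFun]
  map_smul' c f := ext_ev2 fun X Y => by simp [ev2_comulFun]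

@[simp] theorem ev2_comulLin (f : Oq D) (X Y : Uq D) :
    ev2 (comulLin f) (X ⊗ₜ Y) = ev f (X * Y) := ev2_comulFun f X Y

/-- The counit of the quantised coordinate algebra: evaluation at `1`. -/
def counitLin : Oq D →ₗ[ℂ] ℂ := LinearMap.applyₗ (1 : Uq D) ∘ₗ ev

@[simp] theorem counitLin_apply (f : Oq D) : counitLin f = ev f 1 := rfl

theorem ev3_lTensor (t : Oq D ⊗[ℂ] Oq D) (X Y Z : Uq D) :
    ev3 (comulLin.lTensor _ t) (X ⊗ₜ (Y ⊗ₜ Z)) = ev2 t (X ⊗ₜ (Y * Z)) := by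
  induction t using TensorProduct.induction_on with
  | zero => simp
  | add a b ha hb => simp [ha, hb]
  | tmul a b => simp

theorem ev3_assoc (s : Oq D ⊗[ℂ] Oq D) (g : Oq D) (X Y Z : Uq D) :
    ev3 (TensorProduct.assoc ℂ _ _ _ (s ⊗ₜ g)) (X ⊗ₜ (Y ⊗ₜ Z)) = ev2 s (X ⊗ₜ Y) * ev g Z := by
  induction s using TensorProduct.induction_on with
  | zero => simp
  | add a b ha hb => simp [TensorProduct.add_tmul, ha, hb, add_mul]
  | tmul a b => simp [mul_assoc]

theorem ev3_rTensor (t : Oq D ⊗[ℂ] Oq D) (X Y Z : Uq D) :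
    ev3 (TensorProduct.assoc ℂ _ _ _ (comulLin.rTensor _ t)) (X ⊗ₜ (Y ⊗ₜ Z)) =
      ev2 t ((X * Y) ⊗ₜ Z) := by
  induction t using TensorProduct.induction_on with
  | zero => simp
  | add a b ha hb => simp [ha, hb]
  | tmul a b => simp [ev3_assoc]

instance : Coalgebra ℂ (Oq D) where
  comul := comulLin
  counit := counitLin
  coassoc := by
    refine LinearMap.ext fun f => ev3_injective (TensorProduct.ext_threefold' fun X Y Z => ?_)
    change ev3 (TensorProduct.assoc ℂ _ _ _ (comulLin.rTensor _ (comulLin f))) (X ⊗ₜ (Y ⊗ₜ Z)) =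
      ev3 (comulLin.lTensor _ (comulLin f)) (X ⊗ₜ (Y ⊗ₜ Z))
    rw [ev3_rTensor, ev3_lTensor, ev2_comulLin, ev2_comulLin, mul_assoc]
  rTensor_counit_comp_comul := by
    have key : ∀ (t : Oq D ⊗[ℂ] Oq D) (X : Uq D),
        ev (TensorProduct.lid ℂ _ (counitLin.rTensor _ t)) X = ev2 t (1 ⊗ₜ X) := by
      intro t X
      induction t using TensorProduct.induction_on with
      | zero => simp
      | add a b ha hb => simp [ha, hb]
      | tmul a b => simp
    refine LinearMap.ext fun f => (TensorProduct.lid ℂ (Oq D)).injective (ext_ev fun X => ?_)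
    change ev (TensorProduct.lid ℂ _ (counitLin.rTensor _ (comulLin f))) X = _
    rw [key]
    simp
  lTensor_counit_comp_comul := by
    have key : ∀ (t : Oq D ⊗[ℂ] Oq D) (X : Uq D),
        ev (TensorProduct.rid ℂ _ (counitLin.lTensor _ t)) X = ev2 t (X ⊗ₜ 1) := by
      intro t X
      induction t using TensorProduct.induction_on with
      | zero => simp
      | add a b ha hb => simp [ha, hb]
      | tmul a b => simp [mul_comm]
    refine LinearMap.ext fun f => (TensorProduct.rid ℂ (Oq D)).injective (ext_ev fun X => ?_)
    change ev (TensorProduct.rid ℂ _ (counitLin.lTensor _ (comulLin f))) X = _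
    rw [key]
    simp

theorem counit_eq (f : Oq D) : Coalgebra.counit (R := ℂ) f = ev f 1 := rfl

theorem ev2_comul (f : Oq D) (X Y : Uq D) :
    ev2 (Coalgebra.comul (R := ℂ) f) (X ⊗ₜ Y) = ev f (X * Y) := ev2_comulLin f X Y

/-- The pairing of a product of tensors, in terms of the comultiplication of `U_q`. -/
theorem ev2_mul (s t : Oq D ⊗[ℂ] Oq D) (X Y : Uq D) : ev2 (s * t) (X ⊗ₜ Y) =
    LinearMap.mul' ℂ ℂ (TensorProduct.map (ev2 s) (ev2 t)
      (TensorProduct.tensorTensorTensorComm ℂ _ _ _ _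
        (Coalgebra.comul (R := ℂ) X ⊗ₜ Coalgebra.comul (R := ℂ) Y))) := by
  induction s using TensorProduct.induction_on with
  | zero => simp
  | add a b ha hb => simp only [add_mul, map_add, LinearMap.add_apply, ha, hb, TensorProduct.map_add_left]
  | tmul f g =>
    induction t using TensorProduct.induction_on with
    | zero => simp
    | add a b ha hb => simp only [mul_add, map_add, LinearMap.add_apply, ha, hb, TensorProduct.map_add_right]
    | tmul f' g' =>
      rw [Algebra.TensorProduct.tmul_mul_tmul, ev2_tmul, ev_mul, ev_mul]
      generalize Coalgebra.comul (R := ℂ) X = x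
      generalize Coalgebra.comul (R := ℂ) Y = y
      induction x using TensorProduct.induction_on with
      | zero => simp
      | add a b ha hb => simp only [TensorProduct.add_tmul, map_add, add_mul, ha, hb]
      | tmul X1 X2 =>
        induction y using TensorProduct.induction_on with
        | zero => simp
        | add a b ha hb => simp only [TensorProduct.tmul_add, map_add, mul_add, ha, hb]
        | tmul Y1 Y2 => simp; ring

theorem ev_mul_apply_mul (f g : Oq D) (X Y : Uq D) : ev (f * g) (X * Y) =
    LinearMap.mul' ℂ ℂ (TensorProduct.map (ev f ∘ₗ LinearMap.mul' ℂ _)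
      (ev g ∘ₗ LinearMap.mul' ℂ _) (TensorProduct.tensorTensorTensorComm ℂ _ _ _ _
        (Coalgebra.comul (R := ℂ) X ⊗ₜ Coalgebra.comul (R := ℂ) Y))) := by
  rw [ev_mul, Bialgebra.comul_mul]
  generalize Coalgebra.comul (R := ℂ) X = x
  generalize Coalgebra.comul (R := ℂ) Y = y
  induction x using TensorProduct.induction_on with
  | zero => simp
  | add a b ha hb => simp only [TensorProduct.add_tmul, map_add, add_mul, ha, hb]
  | tmul X1 X2 =>
    induction y using TensorProduct.induction_on with
    | zero => simp
    | add a b ha hb => simp only [TensorProduct.tmul_add, map_add, mul_add, ha, hb]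
    | tmul Y1 Y2 => simp

theorem ev2_comul' (f : Oq D) :
    ev2 (Coalgebra.comul (R := ℂ) f) = ev f ∘ₗ LinearMap.mul' ℂ (Uq D) :=
  TensorProduct.ext' fun X Y => ev2_comul f X Y

instance : Bialgebra ℂ (Oq D) := Bialgebra.mk' ℂ (Oq D)
  (by rw [counit_eq, ev_one, Bialgebra.counit_one])
  (by
    intro f g
    rw [counit_eq, ev_mul, Bialgebra.comul_one, Algebra.TensorProduct.one_def]
    rfl)
  (ext_ev2 fun X Y => by
    rw [ev2_comul, Algebra.TensorProduct.one_def, ev2_tmul, ev_one, ev_one, ev_one,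
      Bialgebra.counit_mul])
  (by
    intro f g
    refine ext_ev2 fun X Y => ?_
    rw [ev2_comul, ev2_mul, ev2_comul', ev2_comul', ev_mul_apply_mul])

theorem antipode_mem (f : Oq D) :
    (WithConv.toConv (ev f ∘ₗ Uq.S) : WithConv (Uq D →ₗ[ℂ] ℂ)) ∈ coordAlg D := by
  induction f using span_induction with
  | hcoeff J T j k => exact entry_mem T.dual k j
  | hzero => exact zero_mem _
  | hadd f g hf hg =>
    rw [map_add, LinearMap.add_comp]
    exact add_mem hf hg
  | hsmul c f hf =>
    rw [map_smul, LinearMap.smul_comp]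
    exact Subalgebra.smul_mem _ hf c

/-- The antipode of the quantised coordinate algebra, dual to the antipode of `U_q`. -/
def antipodeLin : Oq D →ₗ[ℂ] Oq D where
  toFun f := ⟨_, antipode_mem f⟩
  map_add' _ _ := rfl
  map_smul' _ _ := rfl

@[simp] theorem ev_antipodeLin (f : Oq D) (X : Uq D) : ev (antipodeLin f) X = ev f (Uq.S X) := rfl

instance : HopfAlgebra ℂ (Oq D) where
  antipode := antipodeLin
  mul_antipode_rTensor_comul := by
    have key : ∀ (t : Oq D ⊗[ℂ] Oq D) (X : Uq D),
        ev (LinearMap.mul' ℂ _ (antipodeLin.rTensor _ t)) X =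
          ev2 t (Uq.S.rTensor _ (Coalgebra.comul (R := ℂ) X)) := by
      intro t X
      induction t using TensorProduct.induction_on with
      | zero => simp
      | add a b ha hb => simp [ha, hb]
      | tmul a b =>
        simp only [LinearMap.rTensor_tmul, LinearMap.mul'_apply, ev_mul]
        induction Coalgebra.comul (R := ℂ) X using TensorProduct.induction_on with
        | zero => simp
        | add a b ha hb => simp only [map_add, ha, hb]
        | tmul Y Z => simp
    refine LinearMap.ext fun f => ext_ev fun X => ?_
    change ev (LinearMap.mul' ℂ _ (antipodeLin.rTensor _ (Coalgebra.comul (R := ℂ) f))) X =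
      ev (algebraMap ℂ (Oq D) (ev f 1)) X
    rw [key, ev2_comul', LinearMap.comp_apply, Uq.S_left, Algebra.algebraMap_eq_smul_one,
      Algebra.algebraMap_eq_smul_one, map_smul, map_smul, LinearMap.smul_apply, ev_one]
    simp [mul_comm]
  mul_antipode_lTensor_comul := by
    have key : ∀ (t : Oq D ⊗[ℂ] Oq D) (X : Uq D),
        ev (LinearMap.mul' ℂ _ (antipodeLin.lTensor _ t)) X =
          ev2 t (Uq.S.lTensor _ (Coalgebra.comul (R := ℂ) X)) := by
      intro t X
      induction t using TensorProduct.induction_on with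
      | zero => simp
      | add a b ha hb => simp [ha, hb]
      | tmul a b =>
        simp only [LinearMap.lTensor_tmul, LinearMap.mul'_apply, ev_mul]
        induction Coalgebra.comul (R := ℂ) X using TensorProduct.induction_on with
        | zero => simp
        | add a b ha hb => simp only [map_add, ha, hb]
        | tmul Y Z => simp
    refine LinearMap.ext fun f => ext_ev fun X => ?_
    change ev (LinearMap.mul' ℂ _ (antipodeLin.lTensor _ (Coalgebra.comul (R := ℂ) f))) X =
      ev (algebraMap ℂ (Oq D) (ev f 1)) X
    rw [key, ev2_comul', LinearMap.comp_apply, Uq.S_right, Algebra.algebraMap_eq_smul_one,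
      Algebra.algebraMap_eq_smul_one, map_smul, map_smul, LinearMap.smul_apply, ev_one]
    simp [mul_comm]

/-- The functional `X ↦ conj (f (S(X)*))`. -/
def starFun (f : Oq D) : Uq D →ₗ[ℂ] ℂ where
  toFun X := starRingEnd ℂ (ev f (Uq.theta X))
  map_add' X Y := by simp
  map_smul' c X := by simp

theorem star_mem (f : Oq D) :
    (WithConv.toConv (starFun f) : WithConv (Uq D →ₗ[ℂ] ℂ)) ∈ coordAlg D := by
  induction f using span_induction with
  | hcoeff J T j k => exact entry_mem T.conj j k
  | hzero =>
    have : starFun (0 : Oq D) = 0 := by ext; simp [starFun]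
    rw [this]; exact zero_mem _
  | hadd f g hf hg =>
    have : starFun (f + g) = starFun f + starFun g := by ext; simp [starFun]
    rw [this]
    exact add_mem hf hg
  | hsmul c f hf =>
    have : starFun (c • f) = starRingEnd ℂ c • starFun f := by ext; simp [starFun]
    rw [this]
    exact Subalgebra.smul_mem _ hf _

instance : Star (Oq D) := ⟨fun f => ⟨_, star_mem f⟩⟩

@[simp] theorem ev_star (f : Oq D) (X : Uq D) :
    ev (star f) X = starRingEnd ℂ (ev f (Uq.theta X)) := rfl

instance : StarRing (Oq D) where
  star_involutive f := ext_ev fun X => by simp [Uq.theta_theta]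
  star_add f g := ext_ev fun X => by simp
  star_mul f g := ext_ev fun X => by
    rw [ev_star, ev_mul, ev_mul, Uq.comul_theta]
    induction Coalgebra.comul (R := ℂ) X using TensorProduct.induction_on with
    | zero => simp
    | add a b ha hb => simp only [map_add, ha, hb]
    | tmul Y Z => simp [mul_comm]

instance : StarModule ℂ (Oq D) where
  star_smul c f := ext_ev fun X => by simp

end Oq

/-! ## The quantised coordinate algebra of a complex simple Lie algebra -/

section Lie

variable {𝔤 : Type u} [LieRing 𝔤] [LieAlgebra ℂ 𝔤] [FiniteDimensional ℂ 𝔤] [LieAlgebra.IsSimple ℂ 𝔤]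
  {𝔥 : LieSubalgebra ℂ 𝔤} [𝔥.IsCartanSubalgebra]
  (b : (LieAlgebra.IsKilling.rootSystem 𝔥).Base)

/-- The squared length of the simple root `i`, for the canonical invariant form of the root system
(the form induced by the Killing form is a multiple of it). -/
def sqLength (i : b.support) : ℤ :=
  ((LieAlgebra.IsKilling.rootSystem 𝔥).posRootForm ℤ).rootLength i

/-- The squared length of the shortest simple roots. -/
def minSqLength : ℤ := sInf (Set.range (sqLength b))

theorem sqLength_pos (i : b.support) : 0 < sqLength b i :=
  RootPairing.RootPositiveForm.rootLength_pos _ _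

theorem minSqLength_mem (i : b.support) : ∃ j, sqLength b j = minSqLength b := by
  have : minSqLength b ∈ Set.range (sqLength b) :=
    Int.csInf_mem ⟨_, i, rfl⟩ ⟨0, by rintro _ ⟨j, rfl⟩; exact (sqLength_pos b j).le⟩
  exact this

theorem minSqLength_le (i : b.support) : minSqLength b ≤ sqLength b i :=
  csInf_le ⟨0, by rintro _ ⟨j, rfl⟩; exact (sqLength_pos b j).le⟩ ⟨i, rfl⟩

theorem sqLength_dvd (i j : b.support) (h : sqLength b i ≤ sqLength b j) :
    sqLength b i ∣ sqLength b j := by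
  have hB := (((LieAlgebra.IsKilling.rootSystem 𝔥).posRootForm ℤ).toInvariantForm).apply_eq_or
    i.1 j.1
  have e : ∀ k : b.support, ((LieAlgebra.IsKilling.rootSystem 𝔥).posRootForm ℤ).toInvariantForm.form
      ((LieAlgebra.IsKilling.rootSystem 𝔥).root k.1)
      ((LieAlgebra.IsKilling.rootSystem 𝔥).root k.1) = ((sqLength b k : ℤ) : ℂ) := fun k =>
    (RootPairing.RootPositiveForm.algebraMap_rootLength
      ((LieAlgebra.IsKilling.rootSystem 𝔥).posRootForm ℤ) k.1).symm
  rw [e, e] at hB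
  have hi := sqLength_pos b i
  have hj := sqLength_pos b j
  norm_cast at hB
  rcases hB with h1 | h1 | h1 | h1 | h1
  · exact ⟨1, by omega⟩
  · exact ⟨1, by omega⟩
  · exact ⟨1, by omega⟩
  · exact ⟨2, by omega⟩
  · exact ⟨3, by omega⟩

theorem minSqLength_dvd (i : b.support) : minSqLength b ∣ sqLength b i := by
  obtain ⟨j, hj⟩ := minSqLength_mem b i
  rw [← hj]
  exact sqLength_dvd b j i (hj ▸ minSqLength_le b i)

/-- The datum of the quantised enveloping algebra `U_q(𝔤)`: the Cartan matrix
`a_ij = ⟨α_i^∨, α_j⟩`, and the half square lengths `d_i` of the simple roots, for the invariant form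
normalised so that the shortest simple roots have square length `2`. -/
def cartanDatum (q : ℝ) (hq0 : q ≠ 0) (hq1 : q ≠ 1) (hq2 : q ≠ -1) : CartanDatum b.support where
  a i j := b.cartanMatrix j i
  d i := (sqLength b i / minSqLength b).toNat
  q := q
  a_self i := b.cartanMatrix_apply_same i
  a_nonpos i j h := b.cartanMatrix_le_zero_of_ne j i h.symm
  symm i j := by
    obtain ⟨k, hk⟩ := minSqLength_mem b i
    have hm : 0 < minSqLength b := hk ▸ sqLength_pos b k
    obtain ⟨x, hx⟩ := minSqLength_dvd b i
    obtain ⟨y, hy⟩ := minSqLength_dvd b j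
    have hx0 : 0 < x := by have := sqLength_pos b i; rw [hx] at this; exact pos_of_mul_pos_right this hm.le
    have hy0 : 0 < y := by have := sqLength_pos b j; rw [hy] at this; exact pos_of_mul_pos_right this hm.le
    have key : b.cartanMatrix j i * sqLength b i = b.cartanMatrix i j * sqLength b j :=
      RootPairing.RootPositiveForm.pairingIn_mul_eq_pairingIn_mul_swap
        ((LieAlgebra.IsKilling.rootSystem 𝔥).posRootForm ℤ) i.1 j.1
    rw [hx, hy, Int.mul_ediv_cancel_left _ hm.ne', Int.mul_ediv_cancel_left _ hm.ne',
      Int.toNat_of_nonneg hx0.le, Int.toNat_of_nonneg hy0.le]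
    rw [hx, hy] at key
    apply mul_left_cancel₀ hm.ne'
    linarith
  d_pos i := by
    obtain ⟨k, hk⟩ := minSqLength_mem b i
    have hm : 0 < minSqLength b := hk ▸ sqLength_pos b k
    have := Int.ediv_pos_of_pos_of_dvd (sqLength_pos b i) hm.le (minSqLength_dvd b i)
    omega
  q_ne_zero := hq0
  q_ne_one := hq1
  q_ne_neg_one := hq2

end Lie

/-! ## Comodules -/

/-- A left coaction of a coalgebra `A` on a vector space `V`. -/
structure LeftCoaction (A : Type*) [Ring A] [HopfAlgebra ℂ A] (V : Type*) [AddCommGroup V]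
    [Module ℂ V] where
  coact : V →ₗ[ℂ] A ⊗[ℂ] V
  coassoc : ∀ v, TensorProduct.assoc ℂ A A V
    (LinearMap.rTensor V (Coalgebra.comul (R := ℂ)) (coact v)) = LinearMap.lTensor A coact (coact v)
  counit : ∀ v, TensorProduct.lid ℂ V
    (LinearMap.rTensor V (Coalgebra.counit (R := ℂ)) (coact v)) = v

namespace LeftCoaction

variable {A : Type*} [Ring A] [HopfAlgebra ℂ A] {V : Type*} [AddCommGroup V] [Module ℂ V]
  {M : Type*} [AddCommGroup M] [Module ℂ M]

/-- `W` is a subcomodule: the coaction maps `W` into the image of `A ⊗ W`. -/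
def IsSubcomodule (δ : LeftCoaction A M) (W : Submodule ℂ M) : Prop :=
  ∀ w ∈ W, δ.coact w ∈ LinearMap.range (LinearMap.lTensor A W.subtype)

/-- Irreducible comodules. -/
def IsIrreducible (δ : LeftCoaction A M) : Prop :=
  Nontrivial M ∧ ∀ W : Submodule ℂ M, δ.IsSubcomodule W → W = ⊥ ∨ W = ⊤

/-- The space of comodule maps from `V` into the subcomodule `W` of `M`. -/
def homs (ν : LeftCoaction A V) (δ : LeftCoaction A M) (W : Submodule ℂ M) :
    Submodule ℂ (V →ₗ[ℂ] M) where
  carrier := {f | (∀ v, f v ∈ W) ∧ ∀ v, δ.coact (f v) = LinearMap.lTensor A f (ν.coact v)}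
  zero_mem' := ⟨fun _ => W.zero_mem, fun v => by simp⟩
  add_mem' {f g} hf hg := ⟨fun v => W.add_mem (hf.1 v) (hg.1 v), fun v => by
    simp [LinearMap.lTensor_add, hf.2 v, hg.2 v]⟩
  smul_mem' c f hf := ⟨fun v => W.smul_mem c (hf.1 v), fun v => by
    simp [LinearMap.lTensor_smul, hf.2 v]⟩

/-- The subcomodule `W` of `M` is multiplicity-free: for every irreducible comodule `V`, the space
of comodule maps `V → W` is at most one-dimensional. (Irreducible comodules are finite-dimensional,
so that all of them have copies in `Type`.) -/
def IsMultiplicityFree (δ : LeftCoaction A M) (W : Submodule ℂ M) : Prop :=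
  ∀ (V : Type) [AddCommGroup V] [Module ℂ V] (ν : LeftCoaction A V), ν.IsIrreducible →
    Module.rank ℂ (ν.homs δ W) ≤ 1

end LeftCoaction

/-! ## Compact matrix quantum group algebras and their homogeneous spaces -/

section CMQGA

variable (A : Type*) [Ring A] [HopfAlgebra ℂ A]

/-- `h` is a Haar functional: it is normalised and bi-invariant. -/
def IsHaar {A : Type*} [Ring A] [HopfAlgebra ℂ A] (h : A →ₗ[ℂ] ℂ) : Prop :=
  h 1 = 1 ∧
  (∀ a, TensorProduct.rid ℂ A (h.lTensor A (Coalgebra.comul (R := ℂ) a)) = h a • 1) ∧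
  (∀ a, TensorProduct.lid ℂ A (h.rTensor A (Coalgebra.comul (R := ℂ) a)) = h a • 1)

/-- A Hopf algebra is cosemisimple if it has a unique Haar functional. -/
def IsCosemisimple : Prop := ∃! h : A →ₗ[ℂ] ℂ, IsHaar h

variable [StarRing A] [StarModule ℂ A]

/-- Compact matrix quantum group algebras: finitely generated cosemisimple Hopf `*`-algebras with
`h(a* a) > 0` for all non-zero `a`. -/
structure IsCMQGA : Prop where
  comul_star : ∀ a : A, Coalgebra.comul (R := ℂ) (star a) = star (Coalgebra.comul (R := ℂ) a)
  finiteType : Algebra.FiniteType ℂ A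
  cosemisimple : IsCosemisimple A
  positive : ∀ h : A →ₗ[ℂ] ℂ, IsHaar h → ∀ a : A, a ≠ 0 →
    0 < (h (star a * a)).re ∧ (h (star a * a)).im = 0

variable (H : Type*) [Ring H] [HopfAlgebra ℂ H] [StarRing H] [StarModule ℂ H]

/-- The data of a CMQGA-homogeneous space: a surjective homomorphism `π : A → H` of Hopf
`*`-algebras between compact matrix quantum group algebras. -/
structure HomogeneousSpace where
  π : A →ₐc[ℂ] H
  surjective : Function.Surjective π
  map_star : ∀ a, π (star a) = star (π a)
  cmqga_left : IsCMQGA A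
  cmqga_right : IsCMQGA H

end CMQGA

namespace HomogeneousSpace

variable {A : Type*} [Ring A] [HopfAlgebra ℂ A] [StarRing A] [StarModule ℂ A]
  {H : Type*} [Ring H] [HopfAlgebra ℂ H] [StarRing H] [StarModule ℂ H]
  (X : HomogeneousSpace A H)

/-- The homogeneous right coaction `(id ⊗ π) ∘ Δ` of `H` on `A`. -/
def rightCoact : A →ₐ[ℂ] A ⊗[ℂ] H :=
  (Algebra.TensorProduct.map (AlgHom.id ℂ A) (X.π : A →ₐ[ℂ] H)).comp (Bialgebra.comulAlgHom ℂ A)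

theorem rightCoact_star (a : A) : X.rightCoact (star a) = star (X.rightCoact a) := by
  change Algebra.TensorProduct.map (AlgHom.id ℂ A) (X.π : A →ₐ[ℂ] H)
    (Coalgebra.comul (R := ℂ) (star a)) = star (Algebra.TensorProduct.map (AlgHom.id ℂ A)
      (X.π : A →ₐ[ℂ] H) (Coalgebra.comul (R := ℂ) a))
  rw [X.cmqga_left.comul_star]
  induction Coalgebra.comul (R := ℂ) a using TensorProduct.induction_on with
  | zero => simp
  | add s t hs ht => simp only [star_add, map_add, hs, ht]
  | tmul s t => simp [X.map_star]

/-- The quantum homogeneous space `B = A^{co(H)}`, as a `*`-subalgebra of `A`. -/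
def coinv : StarSubalgebra ℂ A where
  carrier := {a | X.rightCoact a = a ⊗ₜ 1}
  mul_mem' {a b} ha hb := by
    have ha' : X.rightCoact a = a ⊗ₜ 1 := ha
    have hb' : X.rightCoact b = b ⊗ₜ 1 := hb
    simp [ha', hb']
  add_mem' {a b} ha hb := by
    have ha' : X.rightCoact a = a ⊗ₜ 1 := ha
    have hb' : X.rightCoact b = b ⊗ₜ 1 := hb
    simp [ha', hb', TensorProduct.add_tmul]
  algebraMap_mem' c := by simp [Algebra.TensorProduct.algebraMap_apply]
  star_mem' {a} ha := by
    have ha' : X.rightCoact a = a ⊗ₜ 1 := ha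
    simp [X.rightCoact_star, ha']

/-- The inclusion of `B` into `A`, as a linear map. -/
def coinvVal : X.coinv →ₗ[ℂ] A := X.coinv.subtype.toAlgHom.toLinearMap

theorem comul_coinv (b : X.coinv) :
    Coalgebra.comul (R := ℂ) (b : A) ∈ LinearMap.range (LinearMap.lTensor A X.coinvVal) := by
  let φ : A →ₗ[ℂ] A ⊗[ℂ] H := X.rightCoact.toLinearMap - (TensorProduct.mk ℂ A H).flip 1
  have hex : Function.Exact X.coinvVal φ := by
    intro a
    constructor
    · intro h
      exact ⟨⟨a, sub_eq_zero.mp h⟩, rfl⟩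
    · rintro ⟨c, rfl⟩
      exact sub_eq_zero.mpr c.2
  refine (Module.Flat.lTensor_exact A hex _).mp ?_
  have e1 : ∀ t : A ⊗[ℂ] A, LinearMap.lTensor A (X.π : A →ₐ[ℂ] H).toLinearMap t =
      Algebra.TensorProduct.map (AlgHom.id ℂ A) (X.π : A →ₐ[ℂ] H) t := by
    intro t
    induction t using TensorProduct.induction_on with
    | zero => simp
    | add s t hs ht => simp only [map_add, hs, ht]
    | tmul s t => rfl
  have e2 : ∀ t : A ⊗[ℂ] A, LinearMap.lTensor A X.rightCoact.toLinearMap t =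
      LinearMap.lTensor A (LinearMap.lTensor A (X.π : A →ₐ[ℂ] H).toLinearMap)
        (LinearMap.lTensor A (Coalgebra.comul (R := ℂ)) t) := by
    intro t
    induction t using TensorProduct.induction_on with
    | zero => simp
    | add s t hs ht => simp only [map_add, hs, ht]
    | tmul s t =>
      rw [LinearMap.lTensor_tmul, LinearMap.lTensor_tmul, LinearMap.lTensor_tmul, e1]
      rfl
  have e3 : ∀ t : (A ⊗[ℂ] A) ⊗[ℂ] A,
      LinearMap.lTensor A (LinearMap.lTensor A (X.π : A →ₐ[ℂ] H).toLinearMap)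
        (TensorProduct.assoc ℂ A A A t) =
      TensorProduct.assoc ℂ A A H
        (LinearMap.lTensor (A ⊗[ℂ] A) (X.π : A →ₐ[ℂ] H).toLinearMap t) := by
    intro t
    induction t using TensorProduct.induction_on with
    | zero => simp
    | add s t hs ht => simp only [map_add, hs, ht]
    | tmul s c =>
      induction s using TensorProduct.induction_on with
      | zero => simp
      | add s t hs ht => simp only [TensorProduct.add_tmul, map_add, hs, ht]
      | tmul s t => rfl
  have e4 : ∀ t : A ⊗[ℂ] A, LinearMap.lTensor (A ⊗[ℂ] A) (X.π : A →ₐ[ℂ] H).toLinearMap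
      (LinearMap.rTensor A (Coalgebra.comul (R := ℂ)) t) =
      LinearMap.rTensor H (Coalgebra.comul (R := ℂ))
        (LinearMap.lTensor A (X.π : A →ₐ[ℂ] H).toLinearMap t) := by
    intro t
    induction t using TensorProduct.induction_on with
    | zero => simp
    | add s t hs ht => simp only [map_add, hs, ht]
    | tmul s t => rfl
  have e5 : ∀ t : A ⊗[ℂ] A, TensorProduct.assoc ℂ A A H (t ⊗ₜ 1) =
      LinearMap.lTensor A ((TensorProduct.mk ℂ A H).flip 1) t := by
    intro t
    induction t using TensorProduct.induction_on with
    | zero => simp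
    | add s t hs ht => simp only [TensorProduct.add_tmul, map_add, hs, ht]
    | tmul s t => rfl
  have hb : LinearMap.lTensor A (X.π : A →ₐ[ℂ] H).toLinearMap (Coalgebra.comul (R := ℂ) (b : A)) =
      (b : A) ⊗ₜ 1 := (e1 _).trans b.2
  rw [LinearMap.lTensor_sub, LinearMap.sub_apply, e2, ← Coalgebra.coassoc_apply, e3, e4, hb,
    LinearMap.rTensor_tmul, e5, sub_self]

theorem lTensor_coinvVal_injective : Function.Injective (LinearMap.lTensor A X.coinvVal) :=
  Module.Flat.lTensor_preserves_injective_linearMap _ Subtype.val_injective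

/-- The left coaction of `A` on `B`, the restriction of the comultiplication of `A`. -/
def leftCoact : X.coinv →ₗ[ℂ] A ⊗[ℂ] X.coinv :=
  (LinearEquiv.ofInjective _ X.lTensor_coinvVal_injective).symm.toLinearMap ∘ₗ
    LinearMap.codRestrict _ (Coalgebra.comul (R := ℂ) ∘ₗ X.coinvVal) X.comul_coinv

theorem lTensor_leftCoact (b : X.coinv) :
    LinearMap.lTensor A X.coinvVal (X.leftCoact b) = Coalgebra.comul (R := ℂ) (b : A) :=
  congrArg Subtype.val (LinearEquiv.apply_symm_apply
    (LinearEquiv.ofInjective _ X.lTensor_coinvVal_injective) ⟨_, X.comul_coinv b⟩)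

end HomogeneousSpace

/-! ## Differential calculi and complex structures -/

/-- A differential calculus `Ω` over an algebra `B`: a differential graded algebra, with degree zero
part (identified via `incl` with) `B`, which is generated by the elements `b`, `db`. -/
structure DifferentialCalculus (B : Type*) [Ring B] [Algebra ℂ B] (Ω : Type*) [Ring Ω]
    [Algebra ℂ Ω] where
  form : ℕ → Submodule ℂ Ω
  gradedMonoid : SetLike.GradedMonoid form
  isInternal : DirectSum.IsInternal form
  d : Ω →ₗ[ℂ] Ω
  d_mem : ∀ k, ∀ ω ∈ form k, d ω ∈ form (k + 1)
  d_d : ∀ ω, d (d ω) = 0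
  leibniz : ∀ k, ∀ ω ∈ form k, ∀ η, d (ω * η) = d ω * η + (-1 : ℂ) ^ k • (ω * d η)
  incl : B →ₐ[ℂ] Ω
  incl_injective : Function.Injective incl
  range_incl : LinearMap.range incl.toLinearMap = form 0
  generated : Algebra.adjoin ℂ ((form 0 : Set Ω) ∪ d '' (form 0 : Set Ω)) = ⊤

namespace DifferentialCalculus

variable {B : Type*} [Ring B] [Algebra ℂ B] {Ω : Type*} [Ring Ω] [Algebra ℂ Ω]
  (Γ : DifferentialCalculus B Ω)

/-- The calculus has total degree `m`. -/
def HasTotalDegree (m : ℕ) : Prop := Γ.form m ≠ ⊥ ∧ ∀ k, m < k → Γ.form k = ⊥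

/-- The zeroth cohomology `H⁰ = ker (d : Ω⁰ → Ω¹)`. -/
def H0 : Submodule ℂ Ω := Γ.form 0 ⊓ LinearMap.ker Γ.d

/-- A calculus is connected if `H⁰ = ℂ 1`. -/
def IsConnected : Prop := Γ.H0 = Submodule.span ℂ {1}

end DifferentialCalculus

/-- A differential `*`-calculus. -/
structure StarCalculus (B : Type*) [Ring B] [Algebra ℂ B] [StarRing B] (Ω : Type*) [Ring Ω]
    [Algebra ℂ Ω] extends DifferentialCalculus B Ω where
  st : Ω →ₛₗ[starRingEnd ℂ] Ω
  st_st : ∀ ω, st (st ω) = ω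
  st_incl : ∀ b, st (incl b) = incl (star b)
  st_d : ∀ ω, st (d ω) = d (st ω)
  st_mul : ∀ k l, ∀ ω ∈ form k, ∀ η ∈ form l, st (ω * η) = (-1 : ℂ) ^ (k * l) • (st η * st ω)

/-- A complex structure on a differential `*`-calculus. -/
structure ComplexStructure {B : Type*} [Ring B] [Algebra ℂ B] [StarRing B] {Ω : Type*} [Ring Ω]
    [Algebra ℂ Ω] (Γ : StarCalculus B Ω) where
  form : ℕ × ℕ → Submodule ℂ Ω
  gradedMonoid : SetLike.GradedMonoid form
  isInternal : DirectSum.IsInternal form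
  form_eq : ∀ k, Γ.form k = ⨆ p : {p : ℕ × ℕ // p.1 + p.2 = k}, form p
  st_form : ∀ a b, (Γ.st : Ω → Ω) '' (form (a, b) : Set Ω) = form (b, a)
  d_form : ∀ a b, ∀ ω ∈ form (a, b), Γ.d ω ∈ form (a + 1, b) ⊔ form (a, b + 1)

/-! ## CQH-calculus spaces and CQH-complex spaces -/

variable (A : Type*) [Ring A] [HopfAlgebra ℂ A] [StarRing A] [StarModule ℂ A]
  (H : Type*) [Ring H] [HopfAlgebra ℂ H] [StarRing H] [StarModule ℂ H]
  (Ω : Type*) [Ring Ω] [Algebra ℂ Ω]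

/-- A CMQGA-homogeneous space `B = A^{co(H)}`, with `A` a domain, together with a covariant
differential `*`-calculus `Ω` over `B`. -/
structure CovariantCalculus extends HomogeneousSpace A H where
  isDomain : IsDomain A
  calculus : StarCalculus toHomogeneousSpace.coinv Ω
  coaction : LeftCoaction A Ω
  coact_one : coaction.coact 1 = 1
  coact_mul : ∀ ω η, coaction.coact (ω * η) = coaction.coact ω * coaction.coact η
  coact_incl : ∀ b, coaction.coact (calculus.incl b) =
    LinearMap.lTensor A calculus.incl.toLinearMap (toHomogeneousSpace.leftCoact b)
  coact_d : ∀ ω, coaction.coact (calculus.d ω) = LinearMap.lTensor A calculus.d (coaction.coact ω)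

variable {A H Ω} in
/-- The copy of `B⁺ = B ∩ ker ε` in degree zero. -/
def CovariantCalculus.plus (C : CovariantCalculus A H Ω) : Submodule ℂ Ω :=
  (LinearMap.ker (Coalgebra.counit (R := ℂ) (A := A) ∘ₗ C.coinvVal)).map
    C.calculus.incl.toLinearMap

/-- A CQH-calculus space `(B = A^{co(H)}, Ω, vol)`. The map `vol : Ω^m → B` is extended by zero to
the other degrees. -/
structure CQHCalculusSpace extends CovariantCalculus A H Ω where
  /-- `Ω B⁺ ⊆ B⁺ Ω` -/
  mul_plus_le : ⊤ * toCovariantCalculus.plus ≤ toCovariantCalculus.plus * ⊤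
  /-- `Ω / B⁺ Ω` is finite-dimensional -/
  finite : FiniteDimensional ℂ (Ω ⧸ (toCovariantCalculus.plus * ⊤))
  m : ℕ
  totalDegree : calculus.HasTotalDegree m
  vol : Ω →ₗ[ℂ] toHomogeneousSpace.coinv
  vol_of_ne : ∀ k, k ≠ m → ∀ ω ∈ calculus.form k, vol ω = 0
  vol_bijOn : Set.BijOn vol (calculus.form m) Set.univ
  vol_mul_left : ∀ b, ∀ ω ∈ calculus.form m, vol (calculus.incl b * ω) = b * vol ω
  vol_mul_right : ∀ b, ∀ ω ∈ calculus.form m, vol (ω * calculus.incl b) = vol ω * b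
  vol_coact : ∀ ω ∈ calculus.form m,
    toHomogeneousSpace.leftCoact (vol ω) = LinearMap.lTensor A vol (coaction.coact ω)
  vol_st : ∀ ω ∈ calculus.form m, vol (calculus.st ω) = star (vol ω)
  /-- the integral `h ∘ vol` is closed -/
  closed : ∀ h : A →ₗ[ℂ] ℂ, IsHaar h → ∀ k, k + 1 = m → ∀ ω ∈ calculus.form k,
    h (vol (calculus.d ω)) = 0

/-- A CQH-complex space: a CQH-calculus space with a covariant complex structure. -/
structure CQHComplexSpace extends CQHCalculusSpace A H Ω where
  complexStructure : ComplexStructure calculus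
  covariant : ∀ p, coaction.IsSubcomodule (complexStructure.form p)

section OqG

variable {𝔤 : Type u} [LieRing 𝔤] [LieAlgebra ℂ 𝔤] [FiniteDimensional ℂ 𝔤] [LieAlgebra.IsSimple ℂ 𝔤]
  {𝔥 : LieSubalgebra ℂ 𝔤} [𝔥.IsCartanSubalgebra]

/-- The quantised coordinate algebra `O_q(G)`, for `G` the simply connected group with Lie
algebra `𝔤`. -/
abbrev OqG (b : (LieAlgebra.IsKilling.rootSystem 𝔥).Base) (q : ℝ) (hq0 : q ≠ 0) (hq1 : q ≠ 1)
    (hq2 : q ≠ -1) : Type u :=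
  Oq (cartanDatum b q hq0 hq1 hq2)

end OqG

end

end QuantumHomogeneous

/-! Only the converse direction has content: a line is finite-dimensional, so connectedness gives
finite dimension at once. For the converse, the point is that the zeroth cohomology is not merely a
vector space. By the Leibniz rule it is a unital subalgebra of the degree-zero part, which is a copy
of `B`, and `B` inherits from `A` the absence of zero divisors. The statement is thus an instance of
the fact that a finite-dimensional domain over an algebraically closed field is the field itself.

That fact is proved with one eigenvector. Let x lie in the zeroth cohomology. Left multiplication by
x preserves this finite-dimensional non-zero complex space, so it has an eigenvalue c with an
eigenvector v ≠ 0. Then (x - c)v = 0 is an equation in a domain, and cancelling v gives x = c.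
Commutativity plays no part, which matters because `B` is in general noncommutative. Algebraic
closedness is essential: over the reals, the complex numbers and the quaternions are
finite-dimensional domains of larger dimension.

The classical picture is that of locally constant functions. On a space with finitely many
components they are spanned by the indicator functions of the components, and two different
indicators multiply to zero. A domain has no room for such a pair, so only one component can occur.

The lemmas that carry this are `mul_mem_H0` (closure under products),
`eq_zero_or_eq_zero_of_mul_eq_zero` (cancellation in degree zero),
`isConnected_iff_finiteDimensional_H0` (the eigenvector argument) and
`HomogeneousSpace.isDomain_coinv` (from `A` to `B`). -/

namespace QuantumHomogeneous

/-! ### The zeroth cohomology as a unital algebra without zero divisors. -/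

namespace DifferentialCalculus

variable {B : Type*} [Ring B] [Algebra ℂ B] {Ω : Type*} [Ring Ω] [Algebra ℂ Ω]
  (Γ : DifferentialCalculus B Ω)

theorem one_mem_form_zero : (1 : Ω) ∈ Γ.form 0 :=
  Γ.gradedMonoid.one_mem

/-- A derivation kills the unit: the Leibniz rule applied to 1 · 1, with sign (-1)^0 = 1, reads d1 =
d1 + d1. The structure `DifferentialCalculus` does not list this among its axioms. -/
theorem d_one : Γ.d 1 = 0 := by
  have h := Γ.leibniz 0 1 Γ.one_mem_form_zero 1
  simpa using h

/-- This serves twice: it is the easy inclusion of the scalars in the zeroth cohomology, and it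
makes that space non-zero, so that an operator on it can have an eigenvector. -/
theorem one_mem_H0 : (1 : Ω) ∈ Γ.H0 :=
  ⟨Γ.one_mem_form_zero, Γ.d_one⟩

/-- The zeroth cohomology is closed under multiplication. -/
theorem mul_mem_H0 {x y : Ω} (hx : x ∈ Γ.H0) (hy : y ∈ Γ.H0) : x * y ∈ Γ.H0 := by
  have hdx : Γ.d x = 0 := hx.2
  have hdy : Γ.d y = 0 := hy.2
  -- The grading places the product in degree 0 + 0, which `simpa` reduces to 0. The remaining goal
  -- is closedness: both terms of the Leibniz expansion contain a factor dx = 0 or dy = 0, so the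
  -- sign is immaterial.
  refine ⟨by simpa using Γ.gradedMonoid.mul_mem hx.1 hy.1, ?_⟩
  change Γ.d (x * y) = 0
  rw [Γ.leibniz 0 x hx.1, hdx, hdy, zero_mul, mul_zero, smul_zero, add_zero]

/-- Cancellation cannot be asked of the whole of `Ω`: in a calculus of positive total degree, a
non-zero top form squares to zero. In degree zero it is available, because there every element comes
from `B` along `incl`, which is injective and multiplicative. The product relation can therefore be
pulled back to `B` and split there. -/
theorem eq_zero_or_eq_zero_of_mul_eq_zero [NoZeroDivisors B] {x y : Ω} (hx : x ∈ Γ.form 0)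
    (hy : y ∈ Γ.form 0) (h : x * y = 0) : x = 0 ∨ y = 0 := by
  rw [← Γ.range_incl] at hx hy
  obtain ⟨a, rfl⟩ := hx
  obtain ⟨b, rfl⟩ := hy
  -- Since `incl` is an algebra map, the vanishing product in `Ω` is the image of `a * b`;
  -- injectivity then moves the relation back to `B`.
  have hab : a * b = 0 := Γ.incl_injective (by simpa using h)
  rcases mul_eq_zero.mp hab with rfl | rfl <;> simp

/-- A calculus over a domain is connected if and only if its zeroth cohomology is
finite-dimensional: a finite-dimensional domain over `ℂ` is trivial. -/
theorem isConnected_iff_finiteDimensional_H0 [IsDomain B] :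
    Γ.IsConnected ↔ FiniteDimensional ℂ Γ.H0 := by
  constructor
  · intro h
    -- Connectedness is by definition an equality of submodules, so it can be used to rewrite. What
    -- is left is that the span of one vector is finite-dimensional.
    rw [h]
    infer_instance
  intro hfin
  -- Nontriviality of `Ω` is not assumed; it comes from `B`, where 1 ≠ 0 because `B` is a domain,
  -- and where `incl` reflects the equation 1 = 0.
  have hone : (1 : Ω) ≠ 0 := by
    intro h
    exact one_ne_zero (α := B) (Γ.incl_injective (by simpa using h))
  -- An endomorphism of the zero space has no eigenvalue, so the existence theorem used below needs
  -- a non-zero space. The unit provides one.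
  have : Nontrivial Γ.H0 := ⟨⟨1, Γ.one_mem_H0⟩, 0, fun h => hone (congrArg Subtype.val h)⟩
  -- The scalars lie in the zeroth cohomology because 1 does. The inclusion left open says that
  -- every closed element x of degree zero is a scalar.
  refine le_antisymm (fun x hx => ?_)
    ((Submodule.span_singleton_le_iff_mem _ _).mpr Γ.one_mem_H0)
  -- Multiplication by x on all of `Ω` need not have an eigenvector, since `Ω` may be
  -- infinite-dimensional. Closure under products allows the restriction to the finite-dimensional
  -- zeroth cohomology, where algebraic closedness of ℂ applies.
  let L : Module.End ℂ Γ.H0 :=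
    (LinearMap.mulLeft ℂ x).restrict fun _ hy => Γ.mul_mem_H0 hx hy
  obtain ⟨c, hc⟩ := Module.End.exists_eigenvalue L
  obtain ⟨v, hv⟩ := hc.exists_hasEigenvector
  -- The eigenvector equation of `L` holds in the subspace; applying the inclusion turns it into an
  -- identity between products in `Ω`.
  have hxv : x * (v : Ω) = c • (v : Ω) := congrArg Subtype.val hv.apply_eq_smul
  have hzero : (x - c • 1) * (v : Ω) = 0 := by
    rw [sub_mul, hxv, smul_mul_assoc, one_mul, sub_self]
  -- Both factors have degree zero: x and 1 do, hence so does x - c · 1, and v belongs to the zeroth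
  -- cohomology. Cancellation leaves two cases. Either x = c · 1, which is the claim, or v = 0,
  -- which is excluded because eigenvectors are non-zero.
  rcases Γ.eq_zero_or_eq_zero_of_mul_eq_zero
    (sub_mem hx.1 (Submodule.smul_mem _ c Γ.one_mem_form_zero)) v.2.1 hzero with h | h
  · exact Submodule.mem_span_singleton.mpr ⟨c, (sub_eq_zero.mp h).symm⟩
  · exact absurd (Subtype.ext h) hv.2

end DifferentialCalculus

/-! ### The domain property of the algebra of coinvariants. -/

/-- Being a domain passes to unital subrings: the inclusion of the coinvariants into `A` is an
injective ring homomorphism, so it reflects both 1 ≠ 0 and the absence of zero divisors. The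
eigenvector argument needs this for `B`, whereas the definition of a covariant calculus provides it
for `A`. -/
theorem HomogeneousSpace.isDomain_coinv {A : Type*} [Ring A] [HopfAlgebra ℂ A] [StarRing A]
    [StarModule ℂ A] {H : Type*} [Ring H] [HopfAlgebra ℂ H] [StarRing H] [StarModule ℂ H]
    [IsDomain A] (X : HomogeneousSpace A H) : IsDomain X.coinv :=
  Function.Injective.isDomain X.coinv.subtype.toAlgHom.toRingHom Subtype.val_injective

end QuantumHomogeneous

/-! ### The equivalence for spaces over the quantised coordinate algebra. -/

/-- The general criterion is applied to the calculus underlying `C`, whose degree-zero algebra is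
the algebra of coinvariants. Finite dimension is expressed by `FiniteDimensional` and not through
`finrank`, which takes the value 0 on infinite-dimensional spaces and so could not detect the
condition. -/
theorem mainTheorem11 {𝔤 : Type u} [LieRing 𝔤] [LieAlgebra ℂ 𝔤] [FiniteDimensional ℂ 𝔤]
    [LieAlgebra.IsSimple ℂ 𝔤] {𝔥 : LieSubalgebra ℂ 𝔤} [𝔥.IsCartanSubalgebra]
    (b : (LieAlgebra.IsKilling.rootSystem 𝔥).Base)
    (q : ℝ) (hq0 : q ≠ 0) (hq1 : q ≠ 1) (hq2 : q ≠ -1)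
    {H : Type v} [Ring H] [HopfAlgebra ℂ H] [StarRing H] [StarModule ℂ H]
    {Ω : Type w} [Ring Ω] [Algebra ℂ Ω]
    (C : QuantumHomogeneous.CQHComplexSpace (QuantumHomogeneous.OqG b q hq0 hq1 hq2) H Ω)
    (hC : C.coaction.IsMultiplicityFree (C.calculus.form 0)) :
    C.calculus.IsConnected ↔ FiniteDimensional ℂ C.calculus.H0 := by
  -- That O_q(G) is a domain is part of the data of `C`, so no separate proof for the quantised
  -- coordinate algebra is required. It is put in the context as an instance, from which the next
  -- line obtains the instance for the coinvariants.
  have := C.isDomain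
  have := C.toHomogeneousSpace.isDomain_coinv
  exact C.calculus.toDifferentialCalculus.isConnected_iff_finiteDimensional_H0
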